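/- Let $G$ be a finite group acting linearly on $\mathbb{C}^n$, and let $f:(\mathbb{C}^n,0)\to(\mathbb{C},0)$ be a $G$-invariant analytic function germ with a critical point at the origin. For $r\ge 0$ let $\mathcal{O}^r_G$ be the (finite-dimensional) space of $r$-jets at the origin of $G$-invariant analytic germs that vanish at the origin and have a critical point there, with its usual topology. Let $D^r_G$ be the group of $r$-jets of $G$-equivariant analytic diffeomorphism germs $\varphi:(\mathbb{C}^n,0)\to(\mathbb{C}^n,0)$; it acts on $\mathcal{O}^r_G$ by $j^r\varphi\cdot j^r h=j^r(h\circ\varphi^{-1})$. The germ $f$ is called equivariantly stable if for all sufficiently large $r$ the $D^r_G$-orbit of $j^r f$ is open in $\mathcal{O}^r_G$. Let $J_f=\langle \partial f/\partial x_1,\dots,\partial f/\partial x_n\rangle\subset\mathbb{C}\{x_1,\dots,x_n\}$ be the Jacobian ideal and $Q_f=\mathbb{C}\{x_1,\dots,x_n\}/J_f$ the Jacobian algebra, on which $G$ acts by $(g\cdot h)(x)=h(g^{-1}x)$. Let $\nu(f)=\dim_{\mathbb{C}}(Q_f)^G$ be the (possibly infinite) dimension of the space of $G$-invariant elements of $Q_f$.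 **Theorem 3.1.** The germ $f$ is equivariantly stable if and only if $\nu(f)=1$. -/

import Mathlib

open Filter Topology

namespace EquivariantGerm

noncomputable section

/-- Germs at `0` of arbitrary functions `ℂⁿ → ℂ` form a `ℂ`-algebra (pointwise operations). -/
instance germAlgebra (n : ℕ) : Algebra ℂ (Germ (𝓝 (0 : Fin n → ℂ)) ℂ) :=
  Algebra.ofModule
    (fun c x y => by
      induction x using Germ.inductionOn
      induction y using Germ.inductionOn
      refine Germ.coe_eq.2 (Eventually.of_forall fun t => ?_)
      simp [mul_assoc])
    (fun c x y => by
      induction x using Germ.inductionOn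
      induction y using Germ.inductionOn
      refine Germ.coe_eq.2 (Eventually.of_forall fun t => ?_)
      simp [mul_left_comm])

/-- `ℂ{x₁, …, xₙ}`: the algebra of germs at `0` of functions `ℂⁿ → ℂ` analytic at `0`. -/
def analyticGerms (n : ℕ) : Subalgebra ℂ (Germ (𝓝 (0 : Fin n → ℂ)) ℂ) where
  carrier := {h | ∃ F : (Fin n → ℂ) → ℂ, AnalyticAt ℂ F 0 ∧ (F : Germ (𝓝 (0 : Fin n → ℂ)) ℂ) = h}
  mul_mem' := by
    rintro _ _ ⟨F, hF, rfl⟩ ⟨H, hH, rfl⟩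
    exact ⟨F * H, hF.mul hH, rfl⟩
  add_mem' := by
    rintro _ _ ⟨F, hF, rfl⟩ ⟨H, hH, rfl⟩
    exact ⟨F + H, hF.add hH, rfl⟩
  algebraMap_mem' c := ⟨fun _ => c, analyticAt_const, by
    rw [Algebra.algebraMap_eq_smul_one]
    refine Germ.coe_eq.2 (Eventually.of_forall fun t => ?_)
    simp⟩

/-- The type of analytic function germs on `(ℂⁿ, 0)`. -/
abbrev AGerm (n : ℕ) : Type := ↥(analyticGerms n)

/-- The germ at `0` of a function analytic at `0`. -/
def AGerm.mk {n : ℕ} (F : (Fin n → ℂ) → ℂ) (hF : AnalyticAt ℂ F 0) : AGerm n :=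
  ⟨(F : Germ (𝓝 (0 : Fin n → ℂ)) ℂ), F, hF, rfl⟩

theorem AGerm.ind {n : ℕ} {P : AGerm n → Prop} (H : ∀ F hF, P (AGerm.mk F hF)) (h : AGerm n) :
    P h := by
  obtain ⟨_, F, hF, rfl⟩ := h
  exact H F hF

theorem AGerm.mk_eq {n : ℕ} {F H : (Fin n → ℂ) → ℂ} {hF : AnalyticAt ℂ F 0}
    {hH : AnalyticAt ℂ H 0} : AGerm.mk F hF = AGerm.mk H hH ↔ F =ᶠ[𝓝 0] H :=
  Subtype.ext_iff.trans Germ.coe_eq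

/-- The value `h(0)` of a germ. -/
def AGerm.value {n : ℕ} (h : AGerm n) : ℂ := Germ.value (h : Germ (𝓝 (0 : Fin n → ℂ)) ℂ)

theorem eventuallyEq_dirDeriv {n : ℕ} (v : Fin n → ℂ) {F H : (Fin n → ℂ) → ℂ}
    (h : F =ᶠ[𝓝 0] H) : (fun x => fderiv ℂ F x v) =ᶠ[𝓝 0] (fun x => fderiv ℂ H x v) := by
  have h' : fderiv ℂ F =ᶠ[𝓝 0] fderiv ℂ H := h.fderiv
  filter_upwards [h'] with x hx
  rw [hx]

theorem analyticAt_dirDeriv {n : ℕ} (v : Fin n → ℂ) {F : (Fin n → ℂ) → ℂ}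
    (hF : AnalyticAt ℂ F 0) : AnalyticAt ℂ (fun x => fderiv ℂ F x v) 0 :=
  ((ContinuousLinearMap.apply ℂ ℂ v).analyticAt _).comp hF.fderiv

/-- The partial derivative `∂h/∂xᵢ` of an arbitrary germ. -/
def germPartial {n : ℕ} (i : Fin n) (h : Germ (𝓝 (0 : Fin n → ℂ)) ℂ) :
    Germ (𝓝 (0 : Fin n → ℂ)) ℂ :=
  h.liftOn (fun F => Germ.ofFun (fun x => fderiv ℂ F x (Pi.single i 1)))
    (fun _ _ hFH => Germ.coe_eq.2 (eventuallyEq_dirDeriv _ hFH))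

/-- The partial derivative `∂h/∂xᵢ` of an analytic germ. -/
def AGerm.partialDeriv {n : ℕ} (i : Fin n) (h : AGerm n) : AGerm n :=
  ⟨germPartial i h, by
    obtain ⟨_, F, hF, rfl⟩ := h
    exact ⟨_, analyticAt_dirDeriv _ hF, rfl⟩⟩

theorem AGerm.partialDeriv_mk {n : ℕ} (i : Fin n) (F : (Fin n → ℂ) → ℂ) (hF : AnalyticAt ℂ F 0) :
    (AGerm.mk F hF).partialDeriv i
      = AGerm.mk (fun x => fderiv ℂ F x (Pi.single i 1)) (analyticAt_dirDeriv _ hF) := rfl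

/-- `h` has a critical point at the origin. -/
def IsCritical {n : ℕ} (h : AGerm n) : Prop := ∀ i, (h.partialDeriv i).value = 0

theorem tendsto_zero_of_analytic {n : ℕ} {φ : (Fin n → ℂ) → (Fin n → ℂ)}
    (hφ : AnalyticAt ℂ φ 0) (h0 : φ 0 = 0) : Tendsto φ (𝓝 0) (𝓝 0) := by
  simpa [ContinuousAt, h0] using hφ.continuousAt

/-- The pullback `h ↦ h ∘ φ` of analytic germs along an analytic `φ : (ℂⁿ, 0) → (ℂⁿ, 0)`. -/
def pullback {n : ℕ} (φ : (Fin n → ℂ) → (Fin n → ℂ)) (hφ : AnalyticAt ℂ φ 0) (h0 : φ 0 = 0) :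
    AGerm n →ₐ[ℂ] AGerm n where
  toFun h := ⟨(h : Germ (𝓝 (0 : Fin n → ℂ)) ℂ).compTendsto φ (tendsto_zero_of_analytic hφ h0), by
    obtain ⟨_, F, hF, rfl⟩ := h
    exact ⟨F ∘ φ, AnalyticAt.comp (by rwa [h0]) hφ, rfl⟩⟩
  map_one' := rfl
  map_zero' := rfl
  map_mul' := by
    rintro ⟨_, F, hF, rfl⟩ ⟨_, H, hH, rfl⟩
    rfl
  map_add' := by
    rintro ⟨_, F, hF, rfl⟩ ⟨_, H, hH, rfl⟩
    rfl
  commutes' c := by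
    apply Subtype.ext
    rw [Algebra.algebraMap_eq_smul_one]
    rfl

theorem pullback_mk {n : ℕ} (φ : (Fin n → ℂ) → (Fin n → ℂ)) (hφ : AnalyticAt ℂ φ 0)
    (h0 : φ 0 = 0) (F : (Fin n → ℂ) → ℂ) (hF : AnalyticAt ℂ F 0) :
    pullback φ hφ h0 (AGerm.mk F hF) = AGerm.mk (F ∘ φ) (AnalyticAt.comp (by rwa [h0]) hφ) := rfl

theorem analyticAt_linear {n : ℕ} (A : (Fin n → ℂ) →ₗ[ℂ] (Fin n → ℂ)) (x : Fin n → ℂ) :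
    AnalyticAt ℂ A x :=
  (LinearMap.toContinuousLinearMap A).analyticAt x

section Action

variable {G : Type*} [Group G] {n : ℕ}

/-- The action of `g ∈ G` on germs by changes of coordinates, `(g · h)(x) = h(g⁻¹ x)`. -/
def germAct (ρ : Representation ℂ G (Fin n → ℂ)) (g : G) : AGerm n →ₐ[ℂ] AGerm n :=
  pullback (ρ g⁻¹) (analyticAt_linear _ _) (map_zero _)

theorem germAct_one (ρ : Representation ℂ G (Fin n → ℂ)) (h : AGerm n) :
    germAct ρ 1 h = h := by
  induction h using AGerm.ind with
  | H F hF =>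
    rw [germAct, pullback_mk, AGerm.mk_eq]
    exact Eventually.of_forall fun x => by simp

theorem germAct_mul (ρ : Representation ℂ G (Fin n → ℂ)) (a b : G) (h : AGerm n) :
    germAct ρ (a * b) h = germAct ρ a (germAct ρ b h) := by
  induction h using AGerm.ind with
  | H F hF =>
    rw [germAct, germAct, germAct, pullback_mk, pullback_mk, pullback_mk, AGerm.mk_eq]
    exact Eventually.of_forall fun x => by simp

/-- `h` is a `G`-invariant germ. -/
def IsInvariant (ρ : Representation ℂ G (Fin n → ℂ)) (h : AGerm n) : Prop :=
  ∀ g, germAct ρ g h = h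

/-- The Jacobian ideal `J_f = ⟨∂f/∂x₁, …, ∂f/∂xₙ⟩`. -/
def jacobianIdeal (f : AGerm n) : Ideal (AGerm n) :=
  Ideal.span (Set.range fun i => f.partialDeriv i)

/-- The Jacobian algebra `Q_f = ℂ{x₁, …, xₙ} / J_f`. -/
abbrev JacobianAlgebra (f : AGerm n) : Type := AGerm n ⧸ jacobianIdeal f

/-- Chain rule: `∂f/∂xᵢ ∘ A` lies in the Jacobian ideal of the invariant germ `f`. -/
theorem germAct_partialDeriv_mem (ρ : Representation ℂ G (Fin n → ℂ)) {f : AGerm n}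
    (hf : IsInvariant ρ f) (g : G) (i : Fin n) :
    germAct ρ g (f.partialDeriv i) ∈ jacobianIdeal f := by
  have key : germAct ρ g (f.partialDeriv i)
      = ∑ j, algebraMap ℂ (AGerm n) (ρ g (Pi.single i 1) j) * f.partialDeriv j := by
    have hg := hf g
    induction f using AGerm.ind with
    | H F hF =>
      rw [germAct, pullback_mk, AGerm.mk_eq] at hg
      rw [germAct, AGerm.partialDeriv_mk, pullback_mk]
      have hsum : ∑ j, algebraMap ℂ (AGerm n) (ρ g (Pi.single i 1) j) *
            (AGerm.mk F hF).partialDeriv j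
          = AGerm.mk (fun x => fderiv ℂ F x (ρ g (Pi.single i 1)))
            (analyticAt_dirDeriv _ hF) := by
        apply Subtype.ext
        rw [AddSubmonoidClass.coe_finsetSum]
        have h1 : ∀ j, ((algebraMap ℂ (AGerm n) (ρ g (Pi.single i 1) j) *
            (AGerm.mk F hF).partialDeriv j : AGerm n) : Germ (𝓝 (0 : Fin n → ℂ)) ℂ)
            = Germ.coeRingHom (𝓝 (0 : Fin n → ℂ))
              (fun x => ρ g (Pi.single i 1) j * fderiv ℂ F x (Pi.single j 1)) := by
          intro j
          rw [Algebra.algebraMap_eq_smul_one, smul_mul_assoc, one_mul, AGerm.partialDeriv_mk]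
          rfl
        rw [Finset.sum_congr rfl fun j _ => h1 j, ← map_sum]
        refine Germ.coe_eq.2 (Eventually.of_forall fun x => ?_)
        conv_rhs => rw [pi_eq_sum_univ' (ρ g (Pi.single i 1))]
        simp only [Finset.sum_apply, map_sum, map_smul, smul_eq_mul]
      rw [hsum, AGerm.mk_eq]
      have hd : fderiv ℂ (F ∘ ρ g⁻¹) =ᶠ[𝓝 0] fderiv ℂ F := hg.fderiv
      have hda : ∀ᶠ x in 𝓝 (0 : Fin n → ℂ), AnalyticAt ℂ F (ρ g⁻¹ x) := by
        have := (tendsto_zero_of_analytic (analyticAt_linear (ρ g⁻¹) 0) (map_zero _)).eventually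
          hF.eventually_analyticAt
        exact this
      filter_upwards [hd, hda] with x hx hax
      have hc : fderiv ℂ (F ∘ ρ g⁻¹) x
          = (fderiv ℂ F (ρ g⁻¹ x)).comp (LinearMap.toContinuousLinearMap (ρ g⁻¹)) :=
        (hax.differentiableAt.hasFDerivAt.comp x
          (LinearMap.toContinuousLinearMap (ρ g⁻¹)).hasFDerivAt).fderiv
      rw [← hx, hc]
      simp
  rw [key]
  exact Ideal.sum_mem _ fun j _ =>
    Ideal.mul_mem_left _ _ (Ideal.subset_span (Set.mem_range_self j))

theorem jacobianIdeal_le_comap (ρ : Representation ℂ G (Fin n → ℂ)) {f : AGerm n}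
    (hf : IsInvariant ρ f) (g : G) :
    jacobianIdeal f ≤ (jacobianIdeal f).comap (germAct ρ g) := by
  refine Ideal.span_le.2 ?_
  rintro _ ⟨i, rfl⟩
  exact germAct_partialDeriv_mem ρ hf g i

/-- The equivariant Milnor number `μ_G(f)`: the representation of `G` on the Jacobian algebra
`Q_f` of an invariant germ `f` induced by the action on germs. -/
def equivariantMilnor (ρ : Representation ℂ G (Fin n → ℂ)) (f : AGerm n)
    (hf : IsInvariant ρ f) : Representation ℂ G (JacobianAlgebra f) where
  toFun g := (Ideal.quotientMapₐ (jacobianIdeal f) (germAct ρ g)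
    (jacobianIdeal_le_comap ρ hf g)).toLinearMap
  map_one' := by
    refine LinearMap.ext fun q => ?_
    obtain ⟨h, rfl⟩ := Ideal.Quotient.mk_surjective q
    exact congrArg (Ideal.Quotient.mk _) (germAct_one ρ h)
  map_mul' a b := by
    refine LinearMap.ext fun q => ?_
    obtain ⟨h, rfl⟩ := Ideal.Quotient.mk_surjective q
    exact congrArg (Ideal.Quotient.mk _) (germAct_mul ρ a b h)

/-- `ν(f)`: the dimension (a cardinal, possibly infinite) of the space of invariant elements
of the Jacobian algebra `Q_f`. -/
def nu (ρ : Representation ℂ G (Fin n → ℂ)) (f : AGerm n) (hf : IsInvariant ρ f) : Cardinal :=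
  Module.rank ℂ (equivariantMilnor ρ f hf).invariants

/-- The finite-dimensional space in which `r`-jets at the origin live: families of `k`-linear
forms on `ℂⁿ`, `0 ≤ k ≤ r`, with its usual topology. -/
abbrev JetSpace (n r : ℕ) : Type :=
  (k : Fin (r + 1)) → ContinuousMultilinearMap ℂ (fun _ : Fin (k : ℕ) => Fin n → ℂ) ℂ

/-- The `r`-jet of a germ: all its derivatives at the origin up to order `r`. -/
def jet (r : ℕ) (h : AGerm n) : JetSpace n r :=
  Germ.liftOn (h : Germ (𝓝 (0 : Fin n → ℂ)) ℂ) (fun F k => iteratedFDeriv ℂ (k : ℕ) F 0)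
    (fun _ _ hFH => funext fun k => (hFH.iteratedFDeriv ℂ (k : ℕ)).self_of_nhds)

/-- `𝒪^r_G`: the `r`-jets of the `G`-invariant analytic germs that vanish at the origin and have
a critical point there. It carries the subspace topology. -/
def invariantJets (ρ : Representation ℂ G (Fin n → ℂ)) (r : ℕ) : Set (JetSpace n r) :=
  {a | ∃ h : AGerm n, IsInvariant ρ h ∧ h.value = 0 ∧ IsCritical h ∧ jet r h = a}

/-- A `G`-equivariant (analytic) diffeomorphism germ `(ℂⁿ, 0) → (ℂⁿ, 0)`, through a
representative: it has an analytic inverse near `0` and commutes with `G` near `0`. -/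
structure EquivariantDiffeo (ρ : Representation ℂ G (Fin n → ℂ)) where
  /-- a representative -/
  toFun : (Fin n → ℂ) → (Fin n → ℂ)
  analytic : AnalyticAt ℂ toFun 0
  map_zero : toFun 0 = 0
  exists_inverse : ∃ ψ : (Fin n → ℂ) → (Fin n → ℂ), AnalyticAt ℂ ψ 0 ∧ ψ 0 = 0 ∧
    (∀ᶠ x in 𝓝 0, ψ (toFun x) = x) ∧ (∀ᶠ x in 𝓝 0, toFun (ψ x) = x)
  equivariant : ∀ g, ∀ᶠ x in 𝓝 0, toFun (ρ g x) = ρ g (toFun x)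

/-- The orbit of an `r`-jet `a` under the group `D^r_G` of `r`-jets of `G`-equivariant
diffeomorphism germs. An element `j^r φ` of this group acts by `j^r h ↦ j^r (h ∘ φ⁻¹)`; as `φ`
runs over a group, the inverse may be omitted in the description of the orbit. -/
def jetOrbit (ρ : Representation ℂ G (Fin n → ℂ)) (r : ℕ) (a : JetSpace n r) :
    Set (JetSpace n r) :=
  {b | ∃ (h : AGerm n) (φ : EquivariantDiffeo ρ),
    jet r h = a ∧ jet r (pullback φ.toFun φ.analytic φ.map_zero h) = b}

/-- `f` is equivariantly stable: for all large enough `r` the `D^r_G`-orbit of the `r`-jet of `f`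
is open in `𝒪^r_G`. -/
def IsEquivariantlyStable (ρ : Representation ℂ G (Fin n → ℂ)) (f : AGerm n) : Prop :=
  ∀ᶠ r : ℕ in atTop,
    IsOpen {a : invariantJets ρ r | (a : JetSpace n r) ∈ jetOrbit ρ r (jet r f)}

end Action

end

end EquivariantGerm

namespace EquivariantGerm

noncomputable section

/-! ### Analytic germs as a local algebra; jets as classes modulo powers of the maximal ideal -/

section GermAlgebra

variable {n : ℕ}

/-! Write 𝔪 for the maximal ideal and K for the ideal generated by the invariant germs in 𝔪².

Analytic half. Jets of equivariant fields form a finite-dimensional space, and the orbit of the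
`r`-jet of `f` is the image of its open subset of invertible ones under the analytic map φ ↦ jet of
`f ∘ φ`. Pullback along φ carries the tangent space at the identity to the one at φ, so this map has
constant rank. Full rank makes it open; smaller rank bounds the Hausdorff dimension of the image and
leaves it without interior. Hence (`isOpen_jetOrbit_iff`) the orbit is open exactly when every
invariant germ in 𝔪² is, modulo 𝔪^(r+1), a derivative `w f` along an equivariant field `w` vanishing
at 0.

Algebraic half. By averaging, ν(f) = 1 means that every invariant germ in 𝔪 lies in J_f
(`nu_eq_one_iff`).

If `f` is stable, finiteness of G makes K contain a power of 𝔪, so tangency gives K ⊆ 𝔪 J_f + 𝔪 K,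
and Nakayama gives K ⊆ 𝔪 J_f (`mem_mul_jacobianIdeal`). Squares of invariant linear forms then lie
in 𝔪 J_f, which forces the Hessian to be nondegenerate on invariant vectors; so any invariant germ
in 𝔪 can be corrected by some ∂_v f, with `v` invariant, to an element of K
(`mem_jacobianIdeal_of_le_mul`).

Conversely, an invariant `h` in 𝔪² lying in J_f is `u f` with `u` equivariant, by averaging
coefficients. Since `h` has no linear part, `u 0` is in the kernel of the Hessian, and since
invariant linear forms lie in J_f they all vanish at `u 0`; hence `u 0 = 0`
(`exists_tangentAlong_eq`). Tangency is then exact, and the orbit is open for every `r ≥ 1`. -/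

theorem AGerm.mk_add {F H : (Fin n → ℂ) → ℂ} (hF : AnalyticAt ℂ F 0) (hH : AnalyticAt ℂ H 0) :
    AGerm.mk F hF + AGerm.mk H hH = AGerm.mk (F + H) (hF.add hH) := rfl

theorem AGerm.mk_mul {F H : (Fin n → ℂ) → ℂ} (hF : AnalyticAt ℂ F 0) (hH : AnalyticAt ℂ H 0) :
    AGerm.mk F hF * AGerm.mk H hH = AGerm.mk (F * H) (hF.mul hH) := rfl

theorem AGerm.mk_smul {F : (Fin n → ℂ) → ℂ} (c : ℂ) (hF : AnalyticAt ℂ F 0) :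
    c • AGerm.mk F hF = AGerm.mk (fun x => c * F x) (analyticAt_const.mul hF) := rfl

theorem AGerm.mk_sum {ι : Type*} (s : Finset ι) {F : ι → (Fin n → ℂ) → ℂ}
    (hF : ∀ i, AnalyticAt ℂ (F i) 0) :
    ∑ i ∈ s, AGerm.mk (F i) (hF i)
      = AGerm.mk (fun x => ∑ i ∈ s, F i x) (Finset.analyticAt_fun_sum _ fun i _ => hF i) := by
  classical
  induction s using Finset.induction_on with
  | empty => simp only [Finset.sum_empty]; rfl
  | insert a s ha ih =>
    rw [Finset.sum_insert ha, ih, AGerm.mk_add, AGerm.mk_eq]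
    exact Eventually.of_forall fun x => by simp [Finset.sum_insert ha]

/-- Evaluation at the origin as an algebra homomorphism. -/
def valueHom (n : ℕ) : AGerm n →ₐ[ℂ] ℂ where
  toFun := AGerm.value
  map_one' := rfl
  map_zero' := rfl
  map_mul' := by
    rintro ⟨_, F, hF, rfl⟩ ⟨_, H, hH, rfl⟩
    rfl
  map_add' := by
    rintro ⟨_, F, hF, rfl⟩ ⟨_, H, hH, rfl⟩
    rfl
  commutes' c := by
    have : algebraMap ℂ (AGerm n) c = AGerm.mk (fun _ => c) analyticAt_const := by
      rw [Algebra.algebraMap_eq_smul_one]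
      exact (AGerm.mk_smul (F := fun _ => 1) c analyticAt_const).trans
        (AGerm.mk_eq.2 (Eventually.of_forall fun x => mul_one c))
    rw [this]
    rfl

theorem valueHom_apply (h : AGerm n) : valueHom n h = h.value := rfl

/-- The maximal ideal of germs vanishing at the origin. -/
def maxIdeal (n : ℕ) : Ideal (AGerm n) := RingHom.ker (valueHom n)

theorem mem_maxIdeal {h : AGerm n} : h ∈ maxIdeal n ↔ h.value = 0 := Iff.rfl

theorem isUnit_of_value_ne_zero {h : AGerm n} (hv : h.value ≠ 0) : IsUnit h := by
  induction h using AGerm.ind with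
  | H F hF =>
    have h0 : F 0 ≠ 0 := hv
    refine IsUnit.of_mul_eq_one (AGerm.mk (F⁻¹) (hF.inv h0)) ?_
    rw [AGerm.mk_mul]
    refine Subtype.ext (Germ.coe_eq.2 ?_)
    filter_upwards [hF.continuousAt.eventually_ne h0] with x hx
    simp [hx]

/-- Each `1 + x y` with `x` in 𝔪 has value 1, hence is a unit. This is the locality that Nakayama's
lemma needs. -/
theorem maxIdeal_le_jacobson : maxIdeal n ≤ Ideal.jacobson ⊥ := by
  intro x hx
  rw [Ideal.mem_jacobson_bot]
  intro y
  apply isUnit_of_value_ne_zero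
  rw [← valueHom_apply, map_add, map_mul, map_one, valueHom_apply, mem_maxIdeal.1 hx]
  simp

/-- The directional derivative of germs. -/
def dirDeriv (v : Fin n → ℂ) : Derivation ℂ (AGerm n) (AGerm n) :=
  Derivation.mk'
    { toFun := fun h => ⟨(h : Germ (𝓝 (0 : Fin n → ℂ)) ℂ).liftOn
        (fun F => Germ.ofFun (fun x => fderiv ℂ F x v))
        (fun _ _ hFH => Germ.coe_eq.2 (eventuallyEq_dirDeriv _ hFH)), by
          obtain ⟨_, F, hF, rfl⟩ := h
          exact ⟨_, analyticAt_dirDeriv _ hF, rfl⟩⟩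
      map_add' := by
        rintro ⟨_, F, hF, rfl⟩ ⟨_, H, hH, rfl⟩
        refine Subtype.ext (Germ.coe_eq.2 ?_)
        filter_upwards [hF.eventually_analyticAt, hH.eventually_analyticAt] with x hx hx'
        change fderiv ℂ (F + H) x v = _
        rw [fderiv_add hx.differentiableAt hx'.differentiableAt]
        rfl
      map_smul' := by
        rintro c ⟨_, F, hF, rfl⟩
        refine Subtype.ext (Germ.coe_eq.2 ?_)
        filter_upwards [hF.eventually_analyticAt] with x hx
        change fderiv ℂ (c • F) x v = _
        rw [fderiv_const_smul hx.differentiableAt]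
        rfl }
    (by
      rintro ⟨_, F, hF, rfl⟩ ⟨_, H, hH, rfl⟩
      refine Subtype.ext (Germ.coe_eq.2 ?_)
      filter_upwards [hF.eventually_analyticAt, hH.eventually_analyticAt] with x hx hx'
      change fderiv ℂ (F * H) x v = F x * fderiv ℂ H x v + H x * fderiv ℂ F x v
      rw [fderiv_mul hx.differentiableAt hx'.differentiableAt]
      rfl)

theorem dirDeriv_mk (v : Fin n → ℂ) {F : (Fin n → ℂ) → ℂ} (hF : AnalyticAt ℂ F 0) :
    dirDeriv v (AGerm.mk F hF)
      = AGerm.mk (fun x => fderiv ℂ F x v) (analyticAt_dirDeriv _ hF) := rfl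

theorem dirDeriv_eq_sum (v : Fin n → ℂ) (h : AGerm n) :
    dirDeriv v h = ∑ i, v i • h.partialDeriv i := by
  induction h using AGerm.ind with
  | H F hF =>
    simp_rw [AGerm.partialDeriv_mk, AGerm.mk_smul]
    rw [dirDeriv_mk, AGerm.mk_sum, AGerm.mk_eq]
    refine Eventually.of_forall fun x => ?_
    conv_lhs => rw [pi_eq_sum_univ' v]
    simp only [map_sum, map_smul, smul_eq_mul]

theorem dirDeriv_comm (v w : Fin n → ℂ) (h : AGerm n) :
    dirDeriv v (dirDeriv w h) = dirDeriv w (dirDeriv v h) := by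
  induction h using AGerm.ind with
  | H F hF =>
    rw [dirDeriv_mk, dirDeriv_mk, dirDeriv_mk, dirDeriv_mk, AGerm.mk_eq]
    filter_upwards [hF.eventually_analyticAt] with x hx
    have hs : IsSymmSndFDerivAt ℂ F x :=
      ContDiffAt.isSymmSndFDerivAt (n := 2) hx.contDiffAt (by simp)
    have key : ∀ a b : Fin n → ℂ, fderiv ℂ (fun y => fderiv ℂ F y a) x b
        = fderiv ℂ (fderiv ℂ F) x b a := by
      intro a b
      rw [fderiv_clm_apply hx.fderiv.differentiableAt (differentiableAt_const a)]
      simp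
    rw [key, key]
    exact hs v w

theorem dirDeriv_mem_pow (v : Fin n → ℂ) (N : ℕ) {h : AGerm n} (hh : h ∈ maxIdeal n ^ (N + 1)) :
    dirDeriv v h ∈ maxIdeal n ^ N := by
  induction N generalizing h with
  | zero => simp
  | succ N ih =>
    rw [pow_succ] at hh
    refine Submodule.mul_induction_on hh ?_ ?_
    · intro a ha b hb
      rw [Derivation.leibniz, smul_eq_mul, smul_eq_mul]
      refine Ideal.add_mem _ (Ideal.mul_mem_right _ _ ha) ?_
      rw [pow_succ']
      exact Ideal.mul_mem_mul hb (ih ha)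
    · intro a b ha hb
      rw [map_add]
      exact Ideal.add_mem _ ha hb

/-- By induction: a derivative of order `k + 1` is one of order `k` of a directional derivative, and
differentiating costs only one power of 𝔪. -/
theorem iteratedFDeriv_eq_zero_of_mem_pow {N k : ℕ} (hk : k < N) {F : (Fin n → ℂ) → ℂ}
    (hF : AnalyticAt ℂ F 0) (h : AGerm.mk F hF ∈ maxIdeal n ^ N) :
    iteratedFDeriv ℂ k F 0 = 0 := by
  induction k generalizing N F with
  | zero =>
    have : AGerm.mk F hF ∈ maxIdeal n := Ideal.pow_le_self (by omega) h
    ext m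
    rw [iteratedFDeriv_zero_apply]
    exact this
  | succ k ih =>
    obtain ⟨N, rfl⟩ : ∃ M, N = M + 1 := ⟨N - 1, by omega⟩
    ext m
    have h1 := ih (N := N) (by omega) (analyticAt_dirDeriv _ hF)
      (dirDeriv_mem_pow (m (Fin.last k)) N h)
    rw [iteratedFDeriv_succ_apply_right]
    have h2 := ContinuousLinearMap.iteratedFDeriv_comp_left (𝕜 := ℂ) (i := k) (n := ⊤)
      (ContinuousLinearMap.apply ℂ ℂ (m (Fin.last k))) (f := fderiv ℂ F) (x := 0)
      hF.fderiv.contDiffAt le_top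
    have h3 : iteratedFDeriv ℂ k (fun x => fderiv ℂ F x (m (Fin.last k))) 0 = _ := h2
    rw [h3] at h1
    have := congrArg (fun q => q (Fin.init m)) h1
    simpa using this

theorem analyticAt_coord (i : Fin n) (x : Fin n → ℂ) : AnalyticAt ℂ (fun x : Fin n → ℂ => x i) x :=
  (ContinuousLinearMap.proj (R := ℂ) (φ := fun _ => ℂ) i).analyticAt x

/-- The coordinate functions as germs. -/
def coordGerm (i : Fin n) : AGerm n :=
  AGerm.mk (fun x => x i) (analyticAt_coord i 0)

theorem coordGerm_mem (i : Fin n) : coordGerm i ∈ maxIdeal n := rfl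

/-- Hadamard's lemma, iterated: a series without constant term is `∑ xᵢ Hᵢ`, where the `Hᵢ` are the
components of the shifted series and vanish to one order less. -/
theorem mem_maxIdeal_pow_of_hasFPowerSeriesAt {N : ℕ} {F : (Fin n → ℂ) → ℂ}
    (hF : AnalyticAt ℂ F 0) {p : FormalMultilinearSeries ℂ (Fin n → ℂ) ℂ}
    (hp : HasFPowerSeriesAt F p 0) (hz : ∀ k < N, p k = 0) :
    AGerm.mk F hF ∈ Ideal.span (Set.range (coordGerm (n := n))) ^ N := by
  induction N generalizing F p with
  | zero => simp
  | succ N ih =>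
    obtain ⟨r, hr⟩ := hp
    have hs : HasFPowerSeriesOnBall p.shift.sum p.shift 0 r := by
      have := FormalMultilinearSeries.hasFPowerSeriesOnBall p.shift
        (by rw [FormalMultilinearSeries.radius_shift]; exact hr.r_pos.trans_le hr.r_le)
      rw [FormalMultilinearSeries.radius_shift] at this
      exact this.mono hr.r_pos hr.r_le
    set H := p.shift.sum
    have hHi : ∀ i : Fin n, HasFPowerSeriesAt
        (ContinuousLinearMap.apply ℂ ℂ (Pi.single i 1 : Fin n → ℂ) ∘ H)
        ((ContinuousLinearMap.apply ℂ ℂ (Pi.single i 1 : Fin n → ℂ)).compFormalMultilinearSeries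
          p.shift) 0 := fun i =>
      ((ContinuousLinearMap.apply ℂ ℂ (Pi.single i 1)).comp_hasFPowerSeriesOnBall
        hs).hasFPowerSeriesAt
    have hmem : ∀ i : Fin n, AGerm.mk _ (hHi i).analyticAt
        ∈ Ideal.span (Set.range (coordGerm (n := n))) ^ N := by
      intro i
      refine ih _ (hHi i) fun k hk => ?_
      ext m
      simp [FormalMultilinearSeries.shift, hz (k + 1) (by omega)]
    have hFeq : AGerm.mk F hF = ∑ i, coordGerm i * AGerm.mk _ (hHi i).analyticAt := by
      change _ = ∑ i : Fin n, AGerm.mk ((fun x => x i) * _)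
        ((analyticAt_coord i 0).mul (hHi i).analyticAt)
      rw [AGerm.mk_sum, AGerm.mk_eq]
      filter_upwards [Metric.eball_mem_nhds (0 : Fin n → ℂ) hr.r_pos] with x hx
      have h1 := hr.hasSum hx
      have h2 := (ContinuousLinearMap.apply ℂ ℂ x).hasSum (hs.hasSum hx)
      have h3 : F x = H x x := by
        rw [zero_add] at h1 h2
        refine h1.unique ?_
        rw [hasSum_nat_add_iff' 1 |>.symm]
        have hp0 : p 0 = 0 := hz 0 (by omega)
        simp only [Finset.range_one, Finset.sum_singleton, hp0,
          zero_apply, sub_zero]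
        have hk : ∀ k, p.shift k (fun _ => x) x = p (k + 1) fun _ => x := by
          intro k
          change (p k.succ).curryRight (fun _ => x) x = _
          rw [ContinuousMultilinearMap.curryRight_apply]
          congr 1
          funext j
          refine Fin.lastCases ?_ (fun _ => ?_) j <;> simp
        have h2' : HasSum (fun k => p.shift k (fun _ => x) x) (H x x) := h2
        simpa only [hk] using h2'
      rw [h3]
      have h4 : H x x = H x (∑ i, x i • Pi.single i (1 : ℂ)) := by
        rw [← pi_eq_sum_univ' x]
      rw [h4]
      simp
    rw [hFeq]
    refine Ideal.sum_mem _ fun i _ => ?_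
    rw [pow_succ']
    exact Ideal.mul_mem_mul (Ideal.subset_span (Set.mem_range_self i)) (hmem i)

theorem mem_span_coordGerm_pow {N : ℕ} {F : (Fin n → ℂ) → ℂ} (hF : AnalyticAt ℂ F 0)
    (hz : ∀ k < N, iteratedFDeriv ℂ k F 0 = 0) :
    AGerm.mk F hF ∈ Ideal.span (Set.range (coordGerm (n := n))) ^ N := by
  obtain ⟨p, r, hr⟩ := id hF
  -- The given `p k` need not be symmetric, so vanishing derivatives only kill its diagonal values.
  -- Erasing the terms below `N` leaves the sum unchanged and makes the coefficients themselves
  -- zero.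
  let q : FormalMultilinearSeries ℂ (Fin n → ℂ) ℂ := fun k => if k < N then 0 else p k
  have hq : HasFPowerSeriesOnBall F q 0 r := by
    refine ⟨?_, hr.r_pos, ?_⟩
    · refine hr.r_le.trans ?_
      refine ENNReal.le_of_forall_nnreal_lt fun s hs => ?_
      refine q.le_radius_of_summable_norm ?_
      refine (p.summable_norm_mul_pow hs).of_nonneg_of_le (fun k => by positivity) fun k => ?_
      refine mul_le_mul_of_nonneg_right ?_ (by positivity)
      by_cases hk : k < N <;> simp [q, hk]
    · intro y hy
      convert hr.hasSum hy using 1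
      funext k
      by_cases hk : k < N
      · have h1 := hr.factorial_smul y k
        rw [hz k hk] at h1
        simp only [q, hk, if_true, zero_apply] at h1 ⊢
        exact ((smul_eq_zero.1 h1).resolve_left (Nat.factorial_ne_zero k)).symm
      · simp [q, hk]
  exact mem_maxIdeal_pow_of_hasFPowerSeriesAt hF hq.hasFPowerSeriesAt fun k hk => by simp [q, hk]

theorem maxIdeal_eq_span : maxIdeal n = Ideal.span (Set.range (coordGerm (n := n))) := by
  refine le_antisymm ?_ (Ideal.span_le.2 ?_)
  · intro h hh
    induction h using AGerm.ind with
    | H F hF =>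
      rw [← pow_one (Ideal.span _)]
      refine mem_span_coordGerm_pow hF fun k hk => ?_
      obtain rfl : k = 0 := by omega
      ext m
      rw [iteratedFDeriv_zero_apply]
      exact hh
  · rintro _ ⟨i, rfl⟩
    exact coordGerm_mem i

theorem maxIdeal_fg : (maxIdeal n).FG := by
  rw [maxIdeal_eq_span]
  exact Submodule.fg_span (Set.finite_range _)

/-- Taking `r`-jets is linear. -/
def jetHom (n r : ℕ) : AGerm n →ₗ[ℂ] JetSpace n r where
  toFun := jet r
  map_add' := by
    rintro ⟨_, F, hF, rfl⟩ ⟨_, H, hH, rfl⟩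
    funext k
    exact iteratedFDeriv_add_apply hF.contDiffAt hH.contDiffAt
  map_smul' := by
    rintro c ⟨_, F, hF, rfl⟩
    funext k
    exact iteratedFDeriv_const_smul_apply (a := c) (f := F) (x := 0) hF.contDiffAt

theorem jetHom_apply (r : ℕ) (h : AGerm n) : jetHom n r h = jet r h := rfl

theorem jet_mk (r : ℕ) {F : (Fin n → ℂ) → ℂ} (hF : AnalyticAt ℂ F 0) (k : Fin (r + 1)) :
    jet r (AGerm.mk F hF) k = iteratedFDeriv ℂ k F 0 := rfl

/-- Turns every statement about jets into an ideal congruence. The exponent is `r + 1` because an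
`r`-jet records the orders 0 through `r`. -/
theorem jetHom_eq_zero_iff (r : ℕ) (h : AGerm n) :
    jetHom n r h = 0 ↔ h ∈ maxIdeal n ^ (r + 1) := by
  induction h using AGerm.ind with
  | H F hF =>
    constructor
    · intro hj
      rw [maxIdeal_eq_span]
      exact mem_span_coordGerm_pow hF fun k hk => congrFun hj ⟨k, hk⟩
    · intro hm
      funext k
      exact iteratedFDeriv_eq_zero_of_mem_pow k.2 hF hm

theorem jet_eq_iff {r : ℕ} {h h' : AGerm n} :
    jet r h = jet r h' ↔ h - h' ∈ maxIdeal n ^ (r + 1) := by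
  rw [← jetHom_eq_zero_iff, map_sub, sub_eq_zero]
  rfl

theorem pullback_mem_pow {φ : (Fin n → ℂ) → (Fin n → ℂ)} (hφ : AnalyticAt ℂ φ 0) (h0 : φ 0 = 0)
    (N : ℕ) {h : AGerm n} (hh : h ∈ maxIdeal n ^ N) : pullback φ hφ h0 h ∈ maxIdeal n ^ N := by
  have h1 : (maxIdeal n).map (pullback φ hφ h0) ≤ maxIdeal n := by
    rw [Ideal.map_le_iff_le_comap]
    intro x hx
    induction x using AGerm.ind with
    | H F hF =>
      rw [Ideal.mem_comap, pullback_mk, mem_maxIdeal]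
      change F (φ 0) = 0
      rw [h0]
      exact hx
  have h2 := Ideal.mem_map_of_mem (pullback φ hφ h0) hh
  rw [Ideal.map_pow] at h2
  exact Ideal.pow_right_mono h1 N h2

/-- Taylor polynomials: write `h - h(0) = ∑ cᵢ xᵢ` and approximate the `cᵢ` to one order less. -/
theorem exists_adjoin_sub_mem_pow (N : ℕ) (h : AGerm n) :
    ∃ p ∈ Algebra.adjoin ℂ (Set.range (coordGerm (n := n))), h - p ∈ maxIdeal n ^ N := by
  induction N generalizing h with
  | zero => exact ⟨0, Subalgebra.zero_mem _, by simp⟩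
  | succ N ih =>
    have h1 : h - algebraMap ℂ _ h.value ∈ maxIdeal n := by
      change valueHom n _ = 0
      rw [map_sub, AlgHom.commutes, valueHom_apply]
      simp
    rw [maxIdeal_eq_span] at h1
    obtain ⟨c, hc⟩ := (Submodule.mem_span_range_iff_exists_fun _).1 h1
    choose p hp hpm using fun i => ih (c i)
    refine ⟨algebraMap ℂ _ h.value + ∑ i, p i * coordGerm i, Subalgebra.add_mem _
      (Subalgebra.algebraMap_mem _ _) (Subalgebra.sum_mem _ fun i _ => Subalgebra.mul_mem _ (hp i)
        (Algebra.subset_adjoin ⟨i, rfl⟩)), ?_⟩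
    rw [← sub_sub, ← hc, ← Finset.sum_sub_distrib]
    refine Ideal.sum_mem _ fun i _ => ?_
    rw [smul_eq_mul, ← sub_mul, pow_succ]
    exact Ideal.mul_mem_mul (hpm i) (coordGerm_mem i)

/-- The components of an analytic map germ. -/
def compGerm (φ : (Fin n → ℂ) → (Fin n → ℂ)) (hφ : AnalyticAt ℂ φ 0) (i : Fin n) : AGerm n :=
  AGerm.mk (fun x => φ x i) ((analyticAt_coord i _).comp hφ)

/-- Modulo 𝔪^N the two pullbacks are algebra maps agreeing on coordinates, hence on polynomials, and
the non-polynomial remainder stays in 𝔪^N. So the jet of `h ∘ φ` depends only on the jet of φ. -/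
theorem pullback_sub_mem_pow {φ ψ : (Fin n → ℂ) → (Fin n → ℂ)} (hφ : AnalyticAt ℂ φ 0)
    (h0 : φ 0 = 0) (hψ : AnalyticAt ℂ ψ 0) (h0' : ψ 0 = 0) {N : ℕ}
    (hN : ∀ i, compGerm φ hφ i - compGerm ψ hψ i ∈ maxIdeal n ^ N) (h : AGerm n) :
    pullback φ hφ h0 h - pullback ψ hψ h0' h ∈ maxIdeal n ^ N := by
  obtain ⟨p, hp, hpm⟩ := exists_adjoin_sub_mem_pow N h
  have h1 : pullback φ hφ h0 p - pullback ψ hψ h0' p ∈ maxIdeal n ^ N := by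
    rw [← Ideal.Quotient.eq]
    have : Set.EqOn ((Ideal.Quotient.mkₐ ℂ (maxIdeal n ^ N)).comp (pullback φ hφ h0))
        ((Ideal.Quotient.mkₐ ℂ (maxIdeal n ^ N)).comp (pullback ψ hψ h0'))
        (Algebra.adjoin ℂ (Set.range (coordGerm (n := n)))) := by
      rw [AlgHom.eqOn_adjoin_iff]
      rintro _ ⟨i, rfl⟩
      exact (Ideal.Quotient.eq).2 (hN i)
    exact this hp
  have h2 := pullback_mem_pow hφ h0 N hpm
  have h3 := pullback_mem_pow hψ h0' N hpm
  rw [map_sub] at h2 h3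
  have := Ideal.add_mem _ (Ideal.sub_mem _ h2 h3) h1
  convert this using 1
  ring

end GermAlgebra

/-! ### Images of analytic maps of constant rank -/

section ConstantRank

variable {E F : Type*} [NormedAddCommGroup E] [NormedSpace ℂ E] [FiniteDimensional ℂ E]
  [NormedAddCommGroup F] [NormedSpace ℂ F] [FiniteDimensional ℂ F]

/-- A map with surjective derivatives is open. -/
theorem isOpen_image_of_surjective_fderiv {P : E → F} {U : Set E} (hU : IsOpen U)
    (hP : ∀ u ∈ U, AnalyticAt ℂ P u) (hs : ∀ u ∈ U, (fderiv ℂ P u).range = ⊤) :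
    IsOpen (P '' U) := by
  have : CompleteSpace E := FiniteDimensional.complete ℂ E
  have : CompleteSpace F := FiniteDimensional.complete ℂ F
  rw [isOpen_iff_mem_nhds]
  rintro _ ⟨u, hu, rfl⟩
  rw [← (hP u hu).hasStrictFDerivAt.map_nhds_eq_of_surj (hs u hu)]
  exact image_mem_map (hU.mem_nhds hu)

/-- Near each point, a map of constant rank `k` factors through a `k`-dimensional space. -/
theorem exists_nhds_dimH_image_le {P : E → F} {U : Set E} {k : ℕ} (hU : IsOpen U)
    (hP : ∀ u ∈ U, AnalyticAt ℂ P u)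
    (hk : ∀ u ∈ U, Module.finrank ℂ (fderiv ℂ P u).range = k) {u : E} (hu : u ∈ U) :
    ∃ N ∈ 𝓝 u, dimH (P '' N) ≤ (2 * k : ℕ) := by
  have : CompleteSpace E := FiniteDimensional.complete ℂ E
  have : CompleteSpace F := FiniteDimensional.complete ℂ F
  set A := fderiv ℂ P u
  obtain ⟨π, hπ⟩ := LinearMap.exists_leftInverse_of_injective A.range.subtype
    (Submodule.ker_subtype _)
  obtain ⟨q, hq⟩ := LinearMap.exists_leftInverse_of_injective A.ker.subtype
    (Submodule.ker_subtype _)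
  let πc : F →L[ℂ] A.range := LinearMap.toContinuousLinearMap π
  let qc : E →L[ℂ] A.ker := LinearMap.toContinuousLinearMap q
  -- A chart adapted to `P` at `u`: the component of `P` in the range of its derivative, completed
  -- by a projection to the kernel. Its derivative at `u` is invertible.
  let Φ : E → A.range × A.ker := fun x => (πc (P x), qc x)
  have hΦan : ∀ x ∈ U, ContDiffAt ℂ 1 Φ x := fun x hx =>
    ((πc.contDiff.contDiffAt).comp x (hP x hx).contDiffAt).prodMk qc.contDiff.contDiffAt
  have hΦd : ∀ x ∈ U, HasFDerivAt Φ ((πc.comp (fderiv ℂ P x)).prod qc) x := fun x hx =>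
    (πc.hasFDerivAt.comp x (hP x hx).differentiableAt.hasFDerivAt).prodMk qc.hasFDerivAt
  have hπA : ∀ v (hv : v ∈ A.range), π v = ⟨v, hv⟩ := fun v hv =>
    LinearMap.congr_fun hπ ⟨v, hv⟩
  have hqK : ∀ v (hv : v ∈ A.ker), q v = ⟨v, hv⟩ := fun v hv =>
    LinearMap.congr_fun hq ⟨v, hv⟩
  have hinj : Function.Injective ((πc.comp A).prod qc : E →ₗ[ℂ] A.range × A.ker) := by
    rw [injective_iff_map_eq_zero]
    intro v hv
    have h1 : π (A v) = 0 := congrArg Prod.fst hv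
    have h2 : q v = 0 := congrArg Prod.snd hv
    have h3 : A v = 0 := by
      rw [hπA (A v) ⟨v, rfl⟩] at h1
      exact congrArg Subtype.val h1
    rw [hqK v h3] at h2
    exact congrArg Subtype.val h2
  have hfr : Module.finrank ℂ E = Module.finrank ℂ (A.range × A.ker) := by
    rw [Module.finrank_prod]
    exact (LinearMap.finrank_range_add_finrank_ker (A : E →ₗ[ℂ] F)).symm
  let e : E ≃L[ℂ] A.range × A.ker :=
    (LinearEquiv.ofBijective ((πc.comp A).prod qc : E →ₗ[ℂ] A.range × A.ker) ⟨hinj,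
      (LinearMap.injective_iff_surjective_of_finrank_eq_finrank hfr).1
        hinj⟩).toContinuousLinearEquiv
  have he : HasFDerivAt Φ (e : E →L[ℂ] A.range × A.ker) u := by
    have heq : (e : E →L[ℂ] A.range × A.ker) = (πc.comp (fderiv ℂ P u)).prod qc :=
      ContinuousLinearMap.ext fun v => rfl
    rw [heq]
    exact hΦd u hu
  have hΦu := hΦan u hu
  let g := hΦu.localInverse he (by simp)
  have hgc : ContDiffAt ℂ 1 g (Φ u) := hΦu.to_localInverse he (by simp)
  have hgu : g (Φ u) = u := hΦu.localInverse_apply_image he (by simp)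
  have hst : HasStrictFDerivAt Φ (e : E →L[ℂ] A.range × A.ker) u :=
    hΦu.hasStrictFDerivAt' he (by simp)
  have hright : ∀ᶠ y in 𝓝 (Φ u), Φ (g y) = y := hst.eventually_right_inverse
  have hleft : ∀ᶠ x in 𝓝 u, g (Φ x) = x := hst.eventually_left_inverse
  have hgU : ∀ᶠ y in 𝓝 (Φ u), g y ∈ U := by
    refine hgc.continuousAt.eventually ?_
    rw [hgu]
    exact hU.mem_nhds hu
  have hgd : ∀ᶠ y in 𝓝 (Φ u), ContDiffAt ℂ 1 g y := hgc.eventually (by simp)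
  obtain ⟨ε, hε, hball⟩ := Metric.eventually_nhds_iff_ball.1
    ((hright.eventually_nhds.and hgU).and hgd)
  let R := fun y => P (g y)
  have hRc : ∀ y ∈ Metric.ball (Φ u) ε, ContDiffAt ℂ 1 R y := fun y hy =>
    (hP _ (hball y hy).1.2).contDiffAt.comp y (hball y hy).2
  have hRd : ∀ y ∈ Metric.ball (Φ u) ε, ∀ s : A.ker, fderiv ℂ R y (0, s) = 0 := by
    intro y hy s
    obtain ⟨⟨hr, hyU⟩, hgy⟩ := hball y hy
    have hdg := (hgy.differentiableAt (by simp)).hasFDerivAt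
    have hdP := (hP _ hyU).differentiableAt.hasFDerivAt
    have hcomp : ((πc.comp (fderiv ℂ P (g y))).prod qc).comp (fderiv ℂ g y)
        = ContinuousLinearMap.id ℂ _ :=
      ((hΦd _ hyU).comp y hdg).unique ((hasFDerivAt_id y).congr_of_eventuallyEq hr)
    have hfst : ∀ z, π (fderiv ℂ P (g y) (fderiv ℂ g y z)) = z.1 := fun z =>
      congrArg Prod.fst (DFunLike.congr_fun hcomp z)
    have hRy : fderiv ℂ R y (0, s) = fderiv ℂ P (g y) (fderiv ℂ g y (0, s)) :=
      DFunLike.congr_fun (hdP.comp y hdg).fderiv (0, s)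
    -- Constant rank enters here: π maps the range of the derivative at `g y` onto a space of the
    -- same dimension, hence injectively, and it kills the derivative of `P ∘ g` in the kernel
    -- direction.
    set π' := π.domRestrict (fderiv ℂ P (g y)).range
    have hsurj : Function.Surjective π' := fun t =>
      ⟨⟨_, ⟨fderiv ℂ g y (t, 0), rfl⟩⟩, hfst (t, 0)⟩
    have hinj' : Function.Injective π' :=
      (LinearMap.injective_iff_surjective_of_finrank_eq_finrank
        ((hk _ hyU).trans (hk u hu).symm)).2 hsurj
    have h0 : π' ⟨_, ⟨fderiv ℂ g y (0, s), rfl⟩⟩ = π' 0 := by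
      rw [map_zero]
      exact hfst (0, s)
    rw [hRy]
    exact congrArg Subtype.val (hinj' h0)
  -- In the chart `P` is therefore constant along the kernel factor and is determined by the `k`
  -- remaining complex coordinates.
  have hconst : ∀ y ∈ Metric.ball (Φ u) ε, R y = R (y.1, (Φ u).2) := by
    intro y hy
    have hy' : y ∈ Metric.ball (Φ u).1 ε ×ˢ Metric.ball (Φ u).2 ε := by
      rwa [ball_prod_same]
    have hmem : ∀ s ∈ Metric.ball (Φ u).2 ε, (y.1, s) ∈ Metric.ball (Φ u) ε := by
      intro s hs
      have : (y.1, s) ∈ Metric.ball (Φ u).1 ε ×ˢ Metric.ball (Φ u).2 ε := ⟨hy'.1, hs⟩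
      rwa [ball_prod_same] at this
    have hd : ∀ s ∈ Metric.ball (Φ u).2 ε, HasFDerivAt (fun s => R (y.1, s))
        ((fderiv ℂ R (y.1, s)).comp (ContinuousLinearMap.inr ℂ _ _)) s := fun s hs =>
      ((hRc _ (hmem s hs)).differentiableAt (by simp)).hasFDerivAt.comp s
        (hasFDerivAt_prodMk_right y.1 s)
    refine Metric.isOpen_ball.is_const_of_fderiv_eq_zero (𝕜 := ℂ) (f := fun s => R (y.1, s))
      (convex_ball _ _).isPreconnected
      (fun s hs => (hd s hs).differentiableAt.differentiableWithinAt) (fun s hs => ?_) hy'.2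
      (Metric.mem_ball_self hε)
    rw [(hd s hs).fderiv]
    ext v
    exact hRd _ (hmem s hs) v
  refine ⟨{x | Φ x ∈ Metric.ball (Φ u) ε ∧ g (Φ x) = x}, ?_, ?_⟩
  · exact (hΦu.continuousAt.eventually (Metric.ball_mem_nhds _ hε)).and hleft
  · have hsub : P '' {x | Φ x ∈ Metric.ball (Φ u) ε ∧ g (Φ x) = x}
        ⊆ (fun t => R (t, (Φ u).2)) '' Metric.ball (Φ u).1 ε := by
      rintro _ ⟨x, ⟨hx1, hx2⟩, rfl⟩
      have hx' : Φ x ∈ Metric.ball (Φ u).1 ε ×ˢ Metric.ball (Φ u).2 ε := by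
        rwa [ball_prod_same]
      refine ⟨(Φ x).1, hx'.1, ?_⟩
      change R ((Φ x).1, (Φ u).2) = P x
      rw [← hconst _ hx1]
      change P (g (Φ x)) = P x
      rw [hx2]
    refine (dimH_mono hsub).trans ?_
    have hcd : ContDiffOn ℂ 1 (fun t => R (t, (Φ u).2)) (Metric.ball (Φ u).1 ε) := by
      intro t ht
      have : (t, (Φ u).2) ∈ Metric.ball (Φ u).1 ε ×ˢ Metric.ball (Φ u).2 ε :=
        ⟨ht, Metric.mem_ball_self hε⟩
      rw [ball_prod_same] at this
      exact ((hRc _ this).comp t (contDiffAt_id.prodMk contDiffAt_const)).contDiffWithinAt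
    -- Hausdorff dimension is real, hence the factor 2 in the bound.
    refine ((hcd.restrict_scalars ℝ).dimH_image_le (convex_ball _ _) subset_rfl).trans ?_
    refine (dimH_mono (Set.subset_univ _)).trans ?_
    rw [Real.dimH_univ_eq_finrank, finrank_real_of_complex, hk u hu]

/-- Countably many of the local images, each of Hausdorff dimension at most `2 * k`, cover `P '' U`;
a set with interior would have dimension `2 * finrank ℂ F`. -/
theorem interior_image_eq_empty_of_finrank_lt {P : E → F} {U : Set E} {k : ℕ} (hU : IsOpen U)
    (hP : ∀ u ∈ U, AnalyticAt ℂ P u)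
    (hk : ∀ u ∈ U, Module.finrank ℂ (fderiv ℂ P u).range = k) (hlt : k < Module.finrank ℂ F) :
    interior (P '' U) = ∅ := by
  choose! N hN hdim using fun u hu => exists_nhds_dimH_image_le hU hP hk (u := u) hu
  have : ProperSpace E := FiniteDimensional.proper ℂ E
  obtain ⟨t, htU, htc, ht⟩ := TopologicalSpace.countable_cover_nhdsWithin (s := U) (f := N)
    fun u hu => mem_nhdsWithin_of_mem_nhds (hN u hu)
  have hle : dimH (P '' U) ≤ (2 * k : ℕ) := by
    calc dimH (P '' U) ≤ dimH (⋃ u ∈ t, P '' N u) := by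
          refine dimH_mono ?_
          rw [← Set.image_iUnion₂]
          exact Set.image_mono ht
      _ = ⨆ u ∈ t, dimH (P '' N u) := dimH_bUnion htc _
      _ ≤ _ := iSup₂_le fun u hu => hdim u (htU hu)
  by_contra hne
  rw [Real.dimH_of_nonempty_interior (Set.nonempty_iff_ne_empty.2 hne),
    finrank_real_of_complex] at hle
  have : 2 * Module.finrank ℂ F ≤ 2 * k := by exact_mod_cast hle
  omega

end ConstantRank

/-! ### Jets of analytic families -/

section ParametricJets

variable {E V : Type} [NormedAddCommGroup E] [NormedSpace ℂ E] [NormedAddCommGroup V]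
  [NormedSpace ℂ V]

theorem hasFDerivAt_partial_right {W : Type} [NormedAddCommGroup W] [NormedSpace ℂ W]
    {F : E × V → W} {t : E} {x : V} (hF : DifferentiableAt ℂ F (t, x)) :
    HasFDerivAt (fun y => F (t, y)) ((fderiv ℂ F (t, x)).comp (ContinuousLinearMap.inr ℂ E V)) x :=
  hF.hasFDerivAt.comp x (hasFDerivAt_prodMk_right t x)

theorem hasFDerivAt_partial_left {W : Type} [NormedAddCommGroup W] [NormedSpace ℂ W]
    {F : E × V → W} {t : E} {x : V} (hF : DifferentiableAt ℂ F (t, x)) :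
    HasFDerivAt (fun s => F (s, x)) ((fderiv ℂ F (t, x)).comp (ContinuousLinearMap.inl ℂ E V)) t :=
  hF.hasFDerivAt.comp t (hasFDerivAt_prodMk_left t x)

/-- Peels off the innermost `x`-derivative, for an induction on the order that keeps the parameter
`t` free. -/
theorem iteratedFDeriv_succ_param_eventuallyEq {W : Type} [NormedAddCommGroup W] [NormedSpace ℂ W]
    [CompleteSpace W] {F : E × V → W} {t : E} (hF : AnalyticAt ℂ F (t, 0)) (k : ℕ) :
    (fun t' => iteratedFDeriv ℂ (k + 1) (fun x => F (t', x)) 0) =ᶠ[𝓝 t]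
      fun t' => (continuousMultilinearCurryRightEquiv' ℂ k V W).symm
        (iteratedFDeriv ℂ k
          (fun x => (fderiv ℂ F (t', x)).comp (ContinuousLinearMap.inr ℂ E V)) 0) := by
  filter_upwards [(nhds_prod_eq (x := t) (y := (0 : V)) ▸ hF.eventually_analyticAt).curry]
    with t' ht'
  rw [iteratedFDeriv_succ_eq_comp_right, Function.comp_apply]
  congr 1
  refine (EventuallyEq.iteratedFDeriv ℂ ?_ k).self_of_nhds
  filter_upwards [ht'] with x hx
  exact (hasFDerivAt_partial_right hx.differentiableAt).fderiv

/-- The derivatives in `x` of an analytic family `F(t, x)` depend analytically on `t`, and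
derivatives in `t` and in `x` commute. -/
theorem iteratedFDeriv_param (k : ℕ) {W : Type} [NormedAddCommGroup W] [NormedSpace ℂ W]
    [CompleteSpace W] {F : E × V → W} {t : E} (hF : AnalyticAt ℂ F (t, 0)) :
    AnalyticAt ℂ (fun t' => iteratedFDeriv ℂ k (fun x => F (t', x)) 0) t ∧
      ∀ s, fderiv ℂ (fun t' => iteratedFDeriv ℂ k (fun x => F (t', x)) 0) t s
        = iteratedFDeriv ℂ k (fun x => fderiv ℂ F (t, x) (s, 0)) 0 := by
  -- The codomain must vary: the induction passes from `F` to its `x`-derivative, with values in `V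
  -- →L[ℂ] W`.
  induction k generalizing W with
  | zero =>
    have h1 : AnalyticAt ℂ (fun t' => F (t', 0)) t :=
      hF.comp (f := fun t' => (t', (0 : V))) (analyticAt_id.prod analyticAt_const)
    let C : W →L[ℂ] V [×0]→L[ℂ] W :=
      (continuousMultilinearCurryFin0 ℂ V W).symm.toContinuousLinearEquiv.toContinuousLinearMap
    have h2 : ∀ g : V → W, iteratedFDeriv ℂ 0 g 0 = C (g 0) := fun g => by
      rw [iteratedFDeriv_zero_eq_comp]
      rfl
    simp_rw [h2]
    refine ⟨(C.analyticAt _).comp h1, fun s => ?_⟩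
    have h3 : HasFDerivAt (fun t' => F (t', 0))
        ((fderiv ℂ F (t, 0)).comp (ContinuousLinearMap.inl ℂ E V)) t :=
      hasFDerivAt_partial_left hF.differentiableAt
    have h4 := (C.hasFDerivAt.comp t h3).fderiv
    exact DFunLike.congr_fun h4 s
  | succ k ih =>
    have hF' : AnalyticAt ℂ
        (fun p => (fderiv ℂ F p).comp (ContinuousLinearMap.inr ℂ E V)) (t, 0) :=
      (((ContinuousLinearMap.compL ℂ V (E × V) W).flip
        (ContinuousLinearMap.inr ℂ E V)).analyticAt _).comp hF.fderiv
    obtain ⟨h1, h2⟩ := ih hF'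
    let C := (continuousMultilinearCurryRightEquiv' ℂ k V W).symm
    have heq := iteratedFDeriv_succ_param_eventuallyEq hF k
    have h3 : AnalyticAt ℂ (fun t' => C (iteratedFDeriv ℂ k
        (fun x => (fderiv ℂ F (t', x)).comp (ContinuousLinearMap.inr ℂ E V)) 0)) t :=
      AnalyticAt.comp (g := C) (LinearIsometryEquiv.analyticAt (𝕜 := ℂ) (E := V [×k]→L[ℂ] V →L[ℂ] W)
        (F := V [×(k + 1)]→L[ℂ] W) C _) h1
    refine ⟨h3.congr heq.symm, fun s => ?_⟩
    rw [heq.fderiv_eq]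
    have h4 := ((LinearIsometryEquiv.hasFDerivAt (𝕜 := ℂ) (E := V [×k]→L[ℂ] V →L[ℂ] W)
      (F := V [×(k + 1)]→L[ℂ] W) C).comp t h1.differentiableAt.hasFDerivAt).fderiv
    refine (DFunLike.congr_fun h4 s).trans ?_
    change C (fderiv ℂ _ t s) = _
    rw [h2, iteratedFDeriv_succ_eq_comp_right, Function.comp_apply]
    change C _ = C _
    congr 1
    refine (EventuallyEq.iteratedFDeriv ℂ ?_ k).self_of_nhds
    have hev : ∀ᶠ x in 𝓝 (0 : V), AnalyticAt ℂ F (t, x) :=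
      ((continuous_const.prodMk continuous_id).tendsto' (0 : V) (t, (0 : V)) rfl).eventually
        hF.eventually_analyticAt
    filter_upwards [hev] with x hx
    have hs : IsSymmSndFDerivAt ℂ F (t, x) :=
      ContDiffAt.isSymmSndFDerivAt (n := 2) hx.contDiffAt (by simp)
    have hdd := hx.fderiv.differentiableAt.hasFDerivAt
    have e1 : fderiv ℂ (fun p => (fderiv ℂ F p).comp (ContinuousLinearMap.inr ℂ E V)) (t, x)
        = ((ContinuousLinearMap.compL ℂ V (E × V) W).flip
          (ContinuousLinearMap.inr ℂ E V)).comp (fderiv ℂ (fderiv ℂ F) (t, x)) :=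
      (((ContinuousLinearMap.compL ℂ V (E × V) W).flip
        (ContinuousLinearMap.inr ℂ E V)).hasFDerivAt.comp (t, x) hdd).fderiv
    have hG : HasFDerivAt (fun p => fderiv ℂ F p (s, 0))
        ((ContinuousLinearMap.apply ℂ W (s, (0 : V))).comp (fderiv ℂ (fderiv ℂ F) (t, x)))
        (t, x) := (ContinuousLinearMap.apply ℂ W (s, (0 : V))).hasFDerivAt.comp (t, x) hdd
    have e2 := (hG.comp x (hasFDerivAt_prodMk_right t x)).fderiv
    ext v
    rw [e1]
    refine Eq.trans ?_ (DFunLike.congr_fun e2 v).symm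
    exact hs (s, 0) (0, v)

end ParametricJets

/-! ### Equivariant fields and the tangent spaces to orbits -/

section EquivariantFields

variable {G : Type*} [Group G] {n : ℕ} (ρ : Representation ℂ G (Fin n → ℂ))

theorem tendsto_representation (g : G) : Tendsto (ρ g) (𝓝 0) (𝓝 0) :=
  tendsto_zero_of_analytic (analyticAt_linear _ _) (map_zero _)

/-- Equivariant analytic vector fields vanishing at the origin. -/
def equivariantFields : Submodule ℂ ((Fin n → ℂ) → (Fin n → ℂ)) where
  carrier := {v | AnalyticAt ℂ v 0 ∧ v 0 = 0 ∧ ∀ g, ∀ᶠ x in 𝓝 0, v (ρ g x) = ρ g (v x)}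
  add_mem' := by
    rintro v w ⟨hv, hv0, hvg⟩ ⟨hw, hw0, hwg⟩
    refine ⟨hv.add hw, by simp [hv0, hw0], fun g => ?_⟩
    filter_upwards [hvg g, hwg g] with x h1 h2
    simp [h1, h2]
  zero_mem' := ⟨analyticAt_const, rfl, fun g => Eventually.of_forall fun x => by simp⟩
  smul_mem' := by
    rintro c v ⟨hv, hv0, hvg⟩
    refine ⟨analyticAt_const.smul hv, by simp [hv0], fun g => ?_⟩
    filter_upwards [hvg g] with x h1
    simp [h1]

variable {ρ}

/-- The components of an equivariant field. -/
def fieldComp (v : equivariantFields ρ) (i : Fin n) : AGerm n := compGerm v.1 v.2.1 i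

/-- Pullback of germs along an equivariant map germ. -/
def fieldPullback (v : equivariantFields ρ) : AGerm n →ₐ[ℂ] AGerm n :=
  pullback v.1 v.2.1 v.2.2.1

theorem fieldPullback_mk (v : equivariantFields ρ) {F : (Fin n → ℂ) → ℂ} (hF : AnalyticAt ℂ F 0) :
    fieldPullback v (AGerm.mk F hF) = AGerm.mk (F ∘ v.1)
      (AnalyticAt.comp (by rwa [v.2.2.1]) v.2.1) := rfl

theorem fieldComp_mem (v : equivariantFields ρ) (i : Fin n) : fieldComp v i ∈ maxIdeal n :=
  mem_maxIdeal.2 (congrFun v.2.2.1 i)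

theorem fieldComp_congr {v w : equivariantFields ρ} (h : v.1 =ᶠ[𝓝 0] w.1) (i : Fin n) :
    fieldComp v i = fieldComp w i := by
  rw [fieldComp, fieldComp, compGerm, compGerm, AGerm.mk_eq]
  exact h.mono fun _ hx => congrFun hx i

/-- The identity as an equivariant map germ. -/
def idField : equivariantFields ρ :=
  ⟨id, analyticAt_id, rfl, fun _ => Eventually.of_forall fun _ => rfl⟩

/-- Composition of equivariant map germs. -/
def compField (w φ : equivariantFields ρ) : equivariantFields ρ :=
  ⟨w.1 ∘ φ.1, AnalyticAt.comp (by rw [φ.2.2.1]; exact w.2.1) φ.2.1,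
    by simp [φ.2.2.1, w.2.2.1], fun g => by
      filter_upwards [φ.2.2.2 g,
        (tendsto_zero_of_analytic φ.2.1 φ.2.2.1).eventually (w.2.2.2 g)] with x h1 h2
      simp [h1, h2]⟩

/-- The infinitesimal variation of `f ∘ φ` in the direction of a field `w`. -/
def tangentAlong (φ : equivariantFields ρ) (f : AGerm n) : equivariantFields ρ →ₗ[ℂ] AGerm n where
  toFun w := ∑ i, fieldComp w i * fieldPullback φ (f.partialDeriv i)
  map_add' v w := by
    rw [← Finset.sum_add_distrib]
    refine Finset.sum_congr rfl fun i _ => ?_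
    rw [← add_mul]
    rfl
  map_smul' c w := by
    rw [Finset.smul_sum]
    refine Finset.sum_congr rfl fun i _ => ?_
    rw [← smul_mul_assoc]
    rfl

theorem tangentAlong_apply (φ : equivariantFields ρ) (f : AGerm n) (w : equivariantFields ρ) :
    tangentAlong φ f w = ∑ i, fieldComp w i * fieldPullback φ (f.partialDeriv i) := rfl

theorem tangentAlong_mk (φ w : equivariantFields ρ) {F : (Fin n → ℂ) → ℂ} (hF : AnalyticAt ℂ F 0) :
    ∃ h, tangentAlong φ (AGerm.mk F hF) w = AGerm.mk (fun x => fderiv ℂ F (φ.1 x) (w.1 x)) h := by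
  have hsum : (fun x => fderiv ℂ F (φ.1 x) (w.1 x))
      = fun x => ∑ i, w.1 x i * fderiv ℂ F (φ.1 x) (Pi.single i 1) := by
    funext x
    conv_lhs => rw [pi_eq_sum_univ' (w.1 x)]
    simp only [map_sum, map_smul, smul_eq_mul]
  have han : ∀ i, AnalyticAt ℂ
      (fun x => w.1 x i * fderiv ℂ F (φ.1 x) (Pi.single i 1)) 0 := fun i =>
    ((analyticAt_coord i _).comp w.2.1).mul
      (AnalyticAt.comp (g := fun y => fderiv ℂ F y (Pi.single i 1))
        (by rw [φ.2.2.1]; exact analyticAt_dirDeriv _ hF) φ.2.1)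
  refine ⟨by rw [hsum]; exact Finset.analyticAt_fun_sum _ fun i _ => han i, ?_⟩
  rw [tangentAlong_apply]
  simp_rw [AGerm.partialDeriv_mk, fieldPullback_mk]
  refine (AGerm.mk_sum Finset.univ han).trans (AGerm.mk_eq.2 ?_)
  rw [hsum]

theorem tangentAlong_congr (φ : equivariantFields ρ) (f : AGerm n) {v w : equivariantFields ρ}
    (h : v.1 =ᶠ[𝓝 0] w.1) : tangentAlong φ f v = tangentAlong φ f w := by
  simp_rw [tangentAlong_apply, fieldComp_congr h]

/-- Pullback along φ moves a tangent vector at the identity to one at φ. This homogeneity is the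
source of constant rank. -/
theorem fieldPullback_tangent (φ : equivariantFields ρ) (f : AGerm n) (w : equivariantFields ρ) :
    fieldPullback φ (tangentAlong idField f w) = tangentAlong φ f (compField w φ) := by
  rw [tangentAlong_apply, tangentAlong_apply, map_sum]
  refine Finset.sum_congr rfl fun i _ => ?_
  rw [map_mul]
  congr 1
  generalize f.partialDeriv i = h
  induction h using AGerm.ind with
  | H F hF => rfl

theorem mem_maxIdeal_sq {h : AGerm n} : h ∈ maxIdeal n ^ 2 ↔ h.value = 0 ∧ IsCritical h := by
  constructor
  · intro hh
    refine ⟨mem_maxIdeal.1 (Ideal.pow_le_self (by omega) hh), fun i => ?_⟩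
    have := dirDeriv_mem_pow (Pi.single i 1) 1 hh
    rw [pow_one, mem_maxIdeal] at this
    exact this
  · rintro ⟨hv, hc⟩
    induction h using AGerm.ind with
    | H F hF =>
      rw [maxIdeal_eq_span]
      refine mem_span_coordGerm_pow hF fun k hk => ?_
      obtain rfl | rfl : k = 0 ∨ k = 1 := by omega
      · ext m
        rw [iteratedFDeriv_zero_apply]
        exact hv
      · ext m
        rw [iteratedFDeriv_one_apply, pi_eq_sum_univ' (m 0)]
        simp only [map_sum, map_smul]
        refine Finset.sum_eq_zero fun i _ => ?_
        have : fderiv ℂ F 0 (Pi.single i 1) = 0 := hc i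
        rw [this, smul_zero]

variable (ρ) in
/-- Invariant germs vanishing at the origin and having a critical point there. -/
def invariantGerms : Submodule ℂ (AGerm n) where
  carrier := {h | IsInvariant ρ h ∧ h ∈ maxIdeal n ^ 2}
  add_mem' := by
    rintro a b ⟨ha, ha'⟩ ⟨hb, hb'⟩
    exact ⟨fun g => by rw [map_add, ha, hb], Ideal.add_mem _ ha' hb'⟩
  zero_mem' := ⟨fun g => map_zero _, Ideal.zero_mem _⟩
  smul_mem' := by
    rintro c a ⟨ha, ha'⟩
    exact ⟨fun g => by rw [map_smul, ha], Submodule.smul_of_tower_mem _ c ha'⟩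

theorem fieldPullback_mem_pow (φ : equivariantFields ρ) (N : ℕ) {h : AGerm n}
    (hh : h ∈ maxIdeal n ^ N) : fieldPullback φ h ∈ maxIdeal n ^ N :=
  pullback_mem_pow _ _ N hh

theorem fieldPullback_mem (φ : equivariantFields ρ) {h : AGerm n} (hh : h ∈ invariantGerms ρ) :
    fieldPullback φ h ∈ invariantGerms ρ := by
  refine ⟨fun g => ?_, fieldPullback_mem_pow φ 2 hh.2⟩
  have hg := hh.1 g
  clear hh
  induction h using AGerm.ind with
  | H F hF =>
    rw [germAct, pullback_mk, AGerm.mk_eq] at hg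
    rw [fieldPullback_mk, germAct, pullback_mk, AGerm.mk_eq]
    filter_upwards [(tendsto_zero_of_analytic φ.2.1 φ.2.2.1).eventually hg,
      φ.2.2.2 g⁻¹] with x h1 h2
    simpa [h2] using h1

/-- Invariance comes from differentiating `F ∘ ρ g⁻¹ = F` along an equivariant field; order two,
because both the components of `w` and the partial derivatives of `f` vanish at 0. -/
theorem tangentAlong_mem (φ : equivariantFields ρ) {f : AGerm n} (hf : f ∈ invariantGerms ρ)
    (w : equivariantFields ρ) : tangentAlong φ f w ∈ invariantGerms ρ := by
  refine ⟨fun g => ?_, ?_⟩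
  · have hg := hf.1 g
    clear hf
    induction f using AGerm.ind with
    | H F hF =>
      rw [germAct, pullback_mk, AGerm.mk_eq] at hg
      obtain ⟨h, e⟩ := tangentAlong_mk φ w hF
      rw [e, germAct, pullback_mk, AGerm.mk_eq]
      have hd : fderiv ℂ (F ∘ ρ g⁻¹) =ᶠ[𝓝 0] fderiv ℂ F := hg.fderiv
      have ht := tendsto_zero_of_analytic φ.2.1 φ.2.2.1
      filter_upwards [ht.eventually hd,
        ht.eventually ((tendsto_representation ρ g⁻¹).eventually hF.eventually_analyticAt),
        φ.2.2.2 g⁻¹, w.2.2.2 g⁻¹] with x h1 h2 h3 h4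
      have hc : fderiv ℂ (F ∘ ρ g⁻¹) (φ.1 x)
          = (fderiv ℂ F (ρ g⁻¹ (φ.1 x))).comp (LinearMap.toContinuousLinearMap (ρ g⁻¹)) :=
        (h2.differentiableAt.hasFDerivAt.comp (φ.1 x)
          (LinearMap.toContinuousLinearMap (ρ g⁻¹)).hasFDerivAt).fderiv
      rw [← h1, hc]
      simp [h3, h4]
  · rw [pow_two, tangentAlong_apply]
    refine Ideal.sum_mem _ fun i _ => Ideal.mul_mem_mul (fieldComp_mem w i) ?_
    have h1 := fieldPullback_mem_pow φ 1 (dirDeriv_mem_pow (Pi.single i 1) 1 hf.2)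
    rwa [pow_one] at h1

/-- The inverse function theorem for equivariant germs. -/
theorem exists_inverse_of_isUnit (φ : equivariantFields ρ) (hφ : IsUnit (fderiv ℂ φ.1 0)) :
    ∃ ψ : equivariantFields ρ,
      (∀ᶠ x in 𝓝 0, ψ.1 (φ.1 x) = x) ∧ (∀ᶠ x in 𝓝 0, φ.1 (ψ.1 x) = x) := by
  obtain ⟨φ, hφa, hφ0, hφe⟩ := φ
  obtain ⟨u, hu⟩ := hφ
  let e := ContinuousLinearEquiv.unitsEquiv ℂ (Fin n → ℂ) u
  have hcd : ContDiffAt ℂ ⊤ φ 0 := hφa.contDiffAt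
  have he : HasFDerivAt φ (e : (Fin n → ℂ) →L[ℂ] (Fin n → ℂ)) 0 := by
    have h1 : (e : (Fin n → ℂ) →L[ℂ] (Fin n → ℂ)) = fderiv ℂ φ 0 := by
      rw [← hu]
      rfl
    rw [h1]
    exact hφa.differentiableAt.hasFDerivAt
  let ψ := hcd.localInverse he (by simp)
  have hψc : ContDiffAt ℂ ⊤ ψ (φ 0) := hcd.to_localInverse he (by simp)
  have hst := hcd.hasStrictFDerivAt' he (by simp)
  have hψ0 : ψ (φ 0) = 0 := hcd.localInverse_apply_image he (by simp)
  have hl : ∀ᶠ x in 𝓝 0, ψ (φ x) = x := hst.eventually_left_inverse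
  have hr : ∀ᶠ x in 𝓝 (φ 0), φ (ψ x) = x := hst.eventually_right_inverse
  rw [hφ0] at hψc hψ0 hr
  have hψa : AnalyticAt ℂ ψ 0 := hψc.analyticAt
  have ht := tendsto_zero_of_analytic hψa hψ0
  refine ⟨⟨ψ, hψa, hψ0, fun g => ?_⟩, hl, hr⟩
  -- Equivariance of the inverse: apply `ψ ∘ φ = id` at `ρ g (ψ x)`.
  filter_upwards [hr, ht.eventually (hφe g),
    (((tendsto_representation ρ g).comp ht).eventually hl)] with x h1 h2 h3
  change ψ (φ (ρ g (ψ x))) = _ at h3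
  rw [h2, h1] at h3
  exact h3

theorem isUnit_fderiv_of_inverse {φ ψ : (Fin n → ℂ) → (Fin n → ℂ)} (hφ : AnalyticAt ℂ φ 0)
    (hψ : AnalyticAt ℂ ψ 0) (hφ0 : φ 0 = 0) (hψ0 : ψ 0 = 0) (hl : ∀ᶠ x in 𝓝 0, ψ (φ x) = x)
    (hr : ∀ᶠ x in 𝓝 0, φ (ψ x) = x) : IsUnit (fderiv ℂ φ 0) := by
  have key : ∀ {a b : (Fin n → ℂ) → (Fin n → ℂ)}, AnalyticAt ℂ a 0 → AnalyticAt ℂ b 0 →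
      b 0 = 0 → (∀ᶠ x in 𝓝 0, a (b x) = x) → fderiv ℂ a 0 * fderiv ℂ b 0 = 1 := by
    intro a b ha hb hb0 hab
    have h1 : HasFDerivAt a (fderiv ℂ a 0) (b 0) := by
      rw [hb0]
      exact ha.differentiableAt.hasFDerivAt
    exact (h1.comp 0 hb.differentiableAt.hasFDerivAt).unique
      ((hasFDerivAt_id 0).congr_of_eventuallyEq hab)
  exact isUnit_iff_exists.2 ⟨fderiv ℂ ψ 0, key hφ hψ hψ0 hr, key hψ hφ hφ0 hl⟩

/-- Makes invertibility of a field at 0 a condition on its 1-jet, so that it survives replacing the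
field by another with the same `r`-jet, `r ≥ 1`. -/
theorem fderiv_eq_of_fieldComp_sub_mem {v w : equivariantFields ρ}
    (h : ∀ i, fieldComp v i - fieldComp w i ∈ maxIdeal n ^ 2) :
    fderiv ℂ v.1 0 = fderiv ℂ w.1 0 := by
  ext x i
  have h1 := dirDeriv_mem_pow x 1 (h i)
  rw [pow_one, map_sub] at h1
  have h2 : (dirDeriv x (fieldComp v i)).value = (dirDeriv x (fieldComp w i)).value := by
    have h3 : valueHom n _ = 0 := h1
    rw [map_sub, sub_eq_zero] at h3
    exact h3
  have h4 : ∀ u : equivariantFields ρ,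
      (dirDeriv x (fieldComp u i)).value = fderiv ℂ u.1 0 x i := by
    intro u
    have h5 : HasFDerivAt (fun y => u.1 y i)
        ((ContinuousLinearMap.proj (R := ℂ) (φ := fun _ : Fin n => ℂ) i).comp (fderiv ℂ u.1 0)) 0 :=
      (ContinuousLinearMap.proj (R := ℂ) (φ := fun _ : Fin n => ℂ) i).hasFDerivAt.comp 0
        u.2.1.differentiableAt.hasFDerivAt
    exact DFunLike.congr_fun h5.fderiv x
  rw [← h4, ← h4, h2]

end EquivariantFields

instance finiteDimensional_jetSpace (n r : ℕ) : FiniteDimensional ℂ (JetSpace n r) := by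
  have h : ∀ k : ℕ, FiniteDimensional ℂ
      (ContinuousMultilinearMap ℂ (fun _ : Fin k => Fin n → ℂ) ℂ) := fun k =>
    Module.Finite.of_injective
      ({ toFun := ContinuousMultilinearMap.toMultilinearMap
         map_add' := fun _ _ => rfl
         map_smul' := fun _ _ => rfl } :
        ContinuousMultilinearMap ℂ (fun _ : Fin k => Fin n → ℂ) ℂ →ₗ[ℂ]
          MultilinearMap ℂ (fun _ : Fin k => Fin n → ℂ) ℂ)
      ContinuousMultilinearMap.toMultilinearMap_injective
  exact Module.Finite.pi

/-! ### Linear algebra through a finite-dimensional quotient -/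

section LinearAlgebra

theorem exists_continuousProjection {F : Type*} [NormedAddCommGroup F] [NormedSpace ℂ F]
    [FiniteDimensional ℂ F] (S : Submodule ℂ F) :
    ∃ L : F →L[ℂ] S, ∀ a (ha : a ∈ S), L a = ⟨a, ha⟩ := by
  obtain ⟨L, hL⟩ := LinearMap.exists_leftInverse_of_injective S.subtype (Submodule.ker_subtype S)
  exact ⟨LinearMap.toContinuousLinearMap L, fun a ha => LinearMap.congr_fun hL ⟨a, ha⟩⟩

variable {A J : Type*} [AddCommGroup A] [Module ℂ A] [AddCommGroup J] [Module ℂ J]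
  [FiniteDimensional ℂ J]

theorem exists_finite_family_of_linearMap (j : A →ₗ[ℂ] J) : ∃ (d : ℕ) (v : Fin d → A),
    ∀ w, ∃ t : Fin d → ℂ, j w = j (Fintype.linearCombination ℂ v t) := by
  let b := Module.finBasis ℂ j.range
  choose v hv using fun i => (b i).2
  refine ⟨_, v, fun w => ⟨b.repr ⟨j w, w, rfl⟩, ?_⟩⟩
  rw [Fintype.linearCombination_apply, map_sum]
  simp_rw [map_smul, hv]
  have := congrArg j.range.subtype (b.sum_repr ⟨j w, w, rfl⟩)
  rw [map_sum] at this
  simpa only [map_smul, Submodule.subtype_apply] using this.symm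

/-- Since `p` preserves the kernel of `j`, it induces a map on the image of `j`; extended to θ on
all of `J`, it carries the image of `M` onto that of `M.map p`. -/
theorem finrank_map_map_le (j : A →ₗ[ℂ] J) (p : A →ₗ[ℂ] A)
    (hp : ∀ a, j a = 0 → j (p a) = 0) (M : Submodule ℂ A) :
    Module.finrank ℂ ((M.map p).map j) ≤ Module.finrank ℂ (M.map j) := by
  obtain ⟨s, hs⟩ := LinearMap.exists_rightInverse_of_surjective j.rangeRestrict
    (LinearMap.range_rangeRestrict j)
  obtain ⟨θ, hθ⟩ := LinearMap.exists_extend ((j.comp p).comp s)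
  have key : ∀ a, θ (j a) = j (p a) := by
    intro a
    have h1 : θ (j a) = j (p (s (j.rangeRestrict a))) :=
      LinearMap.congr_fun hθ (j.rangeRestrict a)
    have h2 : j (s (j.rangeRestrict a) - a) = 0 := by
      rw [map_sub, sub_eq_zero]
      exact congrArg Subtype.val (LinearMap.congr_fun hs (j.rangeRestrict a))
    have h3 := hp _ h2
    rw [map_sub, map_sub, sub_eq_zero] at h3
    rw [h1, h3]
  have h4 : (M.map p).map j = (M.map j).map θ := by
    rw [← Submodule.map_comp, ← Submodule.map_comp]
    congr 1
    exact LinearMap.ext fun a => (key a).symm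
  rw [h4]
  exact Submodule.finrank_map_le θ _

theorem finrank_map_map_eq (j : A →ₗ[ℂ] J) (p q : A →ₗ[ℂ] A)
    (hp : ∀ a, j a = 0 → j (p a) = 0) (hq : ∀ a, j a = 0 → j (q a) = 0)
    (hqp : ∀ a, q (p a) = a) (M : Submodule ℂ A) :
    Module.finrank ℂ ((M.map p).map j) = Module.finrank ℂ (M.map j) := by
  refine le_antisymm (finrank_map_map_le j p hp M) ?_
  have h := finrank_map_map_le j q hq (M.map p)
  have e : (M.map p).map q = M := by
    rw [← Submodule.map_comp, LinearMap.ext (f := q.comp p) (g := LinearMap.id) hqp,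
      Submodule.map_id]
  rwa [e] at h

end LinearAlgebra

/-! ### Openness of orbits in terms of tangent spaces -/

section Orbit

variable {G : Type*} [Group G] {n : ℕ} {ρ : Representation ℂ G (Fin n → ℂ)}

variable (ρ) in
/-- Finitely many equivariant fields realize all `r`-jets of equivariant fields. -/
theorem exists_finite_family (r : ℕ) : ∃ (d : ℕ) (v : Fin d → equivariantFields ρ),
    ∀ w : equivariantFields ρ, ∃ t : Fin d → ℂ,
      ∀ i, fieldComp w i - fieldComp (Fintype.linearCombination ℂ v t) i
        ∈ maxIdeal n ^ (r + 1) := by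
  let J : equivariantFields ρ →ₗ[ℂ] Fin n → JetSpace n r :=
    { toFun := fun w i => jetHom n r (fieldComp w i)
      map_add' := fun v w => funext fun i => map_add (jetHom n r) (fieldComp v i) (fieldComp w i)
      map_smul' := fun c w => funext fun i => map_smul (jetHom n r) c (fieldComp w i) }
  obtain ⟨d, v, hv⟩ := exists_finite_family_of_linearMap J
  refine ⟨d, v, fun w => ?_⟩
  obtain ⟨t, ht⟩ := hv w
  refine ⟨t, fun i => ?_⟩
  rw [← jetHom_eq_zero_iff, map_sub, sub_eq_zero]
  exact congrFun ht i

/-- The analytic map parametrizing an orbit of jets, and its derivative. -/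
theorem orbitMap_hasFDeriv (r : ℕ) {d : ℕ} (v : Fin d → equivariantFields ρ) (f : AGerm n)
    (t : Fin d → ℂ) :
    AnalyticAt ℂ (fun t => jet r (fieldPullback (Fintype.linearCombination ℂ v t) f)) t ∧
      ∀ s, fderiv ℂ (fun t => jet r (fieldPullback (Fintype.linearCombination ℂ v t) f)) t s
        = jet r (tangentAlong (Fintype.linearCombination ℂ v t) f
          (Fintype.linearCombination ℂ v s)) := by
  induction f using AGerm.ind with
  | H F hF =>
    set σ := Fintype.linearCombination ℂ v with hσ
    let Ψ : (Fin d → ℂ) × (Fin n → ℂ) → (Fin n → ℂ) := fun p => ∑ i, p.1 i • (v i).1 p.2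
    have hσΨ : ∀ t x, (σ t).1 x = Ψ (t, x) := by
      intro t x
      rw [hσ, Fintype.linearCombination_apply]
      simp [Ψ]
    have hcoord : ∀ (i : Fin d) (p : (Fin d → ℂ) × (Fin n → ℂ)),
        AnalyticAt ℂ (fun p : (Fin d → ℂ) × (Fin n → ℂ) => p.1 i) p := fun i p =>
      ((ContinuousLinearMap.proj (R := ℂ) (φ := fun _ : Fin d => ℂ) i).comp
        (ContinuousLinearMap.fst ℂ (Fin d → ℂ) (Fin n → ℂ))).analyticAt p
    have hΨ : ∀ t, AnalyticAt ℂ Ψ (t, 0) := fun t =>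
      Finset.analyticAt_fun_sum _ fun i _ => (hcoord i _).smul
        (AnalyticAt.comp (g := (v i).1) (v i).2.1 analyticAt_snd)
    have hΨ0 : ∀ t, Ψ (t, 0) = 0 := fun t => by rw [← hσΨ, (σ t).2.2.1]
    have hFΨ : AnalyticAt ℂ (fun p => F (Ψ p)) (t, 0) :=
      AnalyticAt.comp (g := F) (by rw [hΨ0]; exact hF) (hΨ t)
    have hjet : (fun t => jet r (fieldPullback (σ t) (AGerm.mk F hF)))
        = fun t (k : Fin (r + 1)) => iteratedFDeriv ℂ (k : ℕ) (fun x => F (Ψ (t, x))) 0 := by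
      funext t k
      rw [fieldPullback_mk, jet_mk]
      congr 1
      funext x
      exact congrArg F (hσΨ t x)
    rw [hjet]
    have hpar := fun k : Fin (r + 1) => iteratedFDeriv_param (k : ℕ) hFΨ
    refine ⟨analyticAt_pi_iff.2 fun k => (hpar k).1, fun s => ?_⟩
    have hder := (hasFDerivAt_pi (𝕜 := ℂ) (x := t)
      (φ := fun (k : Fin (r + 1)) t => iteratedFDeriv ℂ (k : ℕ) (fun x => F (Ψ (t, x))) 0)).2
      fun k => (hpar k).1.differentiableAt.hasFDerivAt
    rw [hder.fderiv]
    obtain ⟨h, e⟩ := tangentAlong_mk (σ t) (σ s) hF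
    rw [e]
    funext k
    refine ((hpar k).2 s).trans ?_
    rw [jet_mk]
    refine (EventuallyEq.iteratedFDeriv ℂ ?_ (k : ℕ)).self_of_nhds
    have htend : Tendsto (fun x : Fin n → ℂ => (t, x)) (𝓝 0) (𝓝 (t, 0)) :=
      (continuous_const.prodMk continuous_id).tendsto' _ _ rfl
    have hFev : ∀ᶠ x in 𝓝 (0 : Fin n → ℂ), AnalyticAt ℂ F (Ψ (t, x)) := by
      have h1 : Tendsto (fun x => Ψ (t, x)) (𝓝 0) (𝓝 0) := by
        have := (hΨ t).continuousAt.tendsto.comp htend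
        rwa [hΨ0] at this
      exact h1.eventually hF.eventually_analyticAt
    filter_upwards [htend.eventually (hΨ t).eventually_analyticAt, hFev] with x hx hFx
    have h1 : fderiv ℂ (fun p => F (Ψ p)) (t, x) = (fderiv ℂ F (Ψ (t, x))).comp
        (fderiv ℂ Ψ (t, x)) :=
      (hFx.differentiableAt.hasFDerivAt.comp (t, x) hx.differentiableAt.hasFDerivAt).fderiv
    rw [h1, hσΨ, hσΨ]
    change fderiv ℂ F (Ψ (t, x)) (fderiv ℂ Ψ (t, x) (s, 0)) = _
    congr 1
    have h2 := hasFDerivAt_partial_left hx.differentiableAt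
    let Λ : (Fin d → ℂ) →L[ℂ] (Fin n → ℂ) :=
      LinearMap.toContinuousLinearMap (Fintype.linearCombination ℂ fun i => (v i).1 x)
    -- The family Ψ is linear in the parameter, so its `t`-derivative is the family itself evaluated
    -- at `s`.
    have h3 : HasFDerivAt (fun t' => Ψ (t', x)) Λ t := Λ.hasFDerivAt
    exact DFunLike.congr_fun (h2.unique h3) s

/-- The derivative at 0 is linear in the parameters, and units are open. -/
theorem isOpen_setOf_isUnit_fderiv {d : ℕ} (v : Fin d → equivariantFields ρ) :
    IsOpen {t : Fin d → ℂ | IsUnit (fderiv ℂ (Fintype.linearCombination ℂ v t).1 0)} := by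
  have h1 : ∀ t : Fin d → ℂ, fderiv ℂ (Fintype.linearCombination ℂ v t).1 0
      = ∑ i, t i • fderiv ℂ (v i).1 0 := by
    intro t
    have h2 : (Fintype.linearCombination ℂ v t).1 = fun x => ∑ i, t i • (v i).1 x := by
      funext x
      rw [Fintype.linearCombination_apply]
      simp
    rw [h2]
    exact (HasFDerivAt.fun_sum fun i _ =>
      ((v i).2.1.differentiableAt.hasFDerivAt.const_smul (t i))).fderiv
  simp_rw [h1]
  exact Units.isOpen.preimage (f := fun t : Fin d → ℂ => ∑ i, t i • fderiv ℂ (v i).1 0)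
    (by fun_prop)

/-- The orbit of the `r`-jet of `f` is parametrized by jets of equivariant fields. -/
theorem mem_jetOrbit_iff {r : ℕ} (hr : 1 ≤ r) {d : ℕ} {v : Fin d → equivariantFields ρ}
    (hv : ∀ w : equivariantFields ρ, ∃ t : Fin d → ℂ,
      ∀ i, fieldComp w i - fieldComp (Fintype.linearCombination ℂ v t) i
        ∈ maxIdeal n ^ (r + 1)) (f : AGerm n) (b : JetSpace n r) :
    b ∈ jetOrbit ρ r (jet r f) ↔ ∃ t : Fin d → ℂ,
      IsUnit (fderiv ℂ (Fintype.linearCombination ℂ v t).1 0) ∧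
        jet r (fieldPullback (Fintype.linearCombination ℂ v t) f) = b := by
  constructor
  · rintro ⟨h, φ, hj, rfl⟩
    let w : equivariantFields ρ := ⟨φ.toFun, φ.analytic, φ.map_zero, φ.equivariant⟩
    obtain ⟨t, ht⟩ := hv w
    refine ⟨t, ?_, ?_⟩
    · rw [← fderiv_eq_of_fieldComp_sub_mem (v := w)
        fun i => Ideal.pow_le_pow_right (by omega) (ht i)]
      obtain ⟨ψ, hψ, hψ0, hl, hr'⟩ := φ.exists_inverse
      exact isUnit_fderiv_of_inverse φ.analytic hψ φ.map_zero hψ0 hl hr'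
    · rw [jet_eq_iff] at hj ⊢
      have h1 := fieldPullback_mem_pow w (r + 1) hj
      rw [map_sub] at h1
      have h2 : fieldPullback w f - fieldPullback (Fintype.linearCombination ℂ v t) f
          ∈ maxIdeal n ^ (r + 1) := pullback_sub_mem_pow _ _ _ _ ht f
      have h3 := Ideal.neg_mem_iff _ |>.2 (Ideal.add_mem _ h1 h2)
      convert h3 using 1
      change _ - fieldPullback w h = _
      ring
  · rintro ⟨t, ht, rfl⟩
    obtain ⟨ψ, hl, hr'⟩ := exists_inverse_of_isUnit _ ht
    let φ := Fintype.linearCombination ℂ v t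
    exact ⟨f, ⟨φ.1, φ.2.1, φ.2.2.1, ⟨ψ.1, ψ.2.1, ψ.2.2.1, hl, hr'⟩, φ.2.2.2⟩, rfl, rfl⟩

theorem range_tangentAlong {φ : equivariantFields ρ} (hφ : IsUnit (fderiv ℂ φ.1 0))
    (f : AGerm n) :
    (tangentAlong φ f).range
      = (tangentAlong (idField (ρ := ρ)) f).range.map (fieldPullback φ).toLinearMap := by
  obtain ⟨ψ, hl, hr⟩ := exists_inverse_of_isUnit φ hφ
  refine le_antisymm ?_ ?_
  · rintro _ ⟨w, rfl⟩
    refine ⟨_, ⟨compField w ψ, rfl⟩, ?_⟩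
    rw [AlgHom.toLinearMap_apply, fieldPullback_tangent]
    exact tangentAlong_congr _ _ (hl.mono fun x hx => congrArg w.1 hx)
  · rintro _ ⟨_, ⟨w, rfl⟩, rfl⟩
    exact ⟨compField w φ, (fieldPullback_tangent φ f w).symm⟩

theorem fieldPullback_fieldPullback {φ ψ : equivariantFields ρ}
    (h : ∀ᶠ x in 𝓝 0, φ.1 (ψ.1 x) = x) (a : AGerm n) :
    fieldPullback ψ (fieldPullback φ a) = a := by
  induction a using AGerm.ind with
  | H F hF =>
    rw [fieldPullback_mk, fieldPullback_mk, AGerm.mk_eq]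
    exact h.mono fun x hx => congrArg F hx

/-- Pullback along φ is invertible and both it and its inverse preserve powers of 𝔪, so they act on
jets without changing dimensions. This is the constancy of the rank. -/
theorem finrank_tangentAlong {φ : equivariantFields ρ} (hφ : IsUnit (fderiv ℂ φ.1 0))
    (f : AGerm n) (r : ℕ) :
    Module.finrank ℂ ((tangentAlong φ f).range.map (jetHom n r))
      = Module.finrank ℂ ((tangentAlong (idField (ρ := ρ)) f).range.map (jetHom n r)) := by
  obtain ⟨ψ, hl, hr⟩ := exists_inverse_of_isUnit φ hφ
  rw [range_tangentAlong hφ]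
  refine finrank_map_map_eq _ _ (fieldPullback ψ).toLinearMap ?_ ?_
    (fieldPullback_fieldPullback hr) _
  · intro a ha
    rw [jetHom_eq_zero_iff] at ha ⊢
    exact fieldPullback_mem_pow _ _ ha
  · intro a ha
    rw [jetHom_eq_zero_iff] at ha ⊢
    exact fieldPullback_mem_pow _ _ ha

variable (ρ) in
/-- The space of jets of invariant germs, as a subspace of the jet space. -/
def invariantJetSpace (r : ℕ) : Submodule ℂ (JetSpace n r) :=
  ((invariantGerms ρ).map (jetHom n r)).copy (invariantJets ρ r) (by
    ext a
    constructor
    · rintro ⟨h, hi, hv, hc, rfl⟩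
      exact ⟨h, ⟨hi, mem_maxIdeal_sq.2 ⟨hv, hc⟩⟩, rfl⟩
    · rintro ⟨h, ⟨hi, hm⟩, rfl⟩
      exact ⟨h, hi, (mem_maxIdeal_sq.1 hm).1, (mem_maxIdeal_sq.1 hm).2, rfl⟩)

theorem invariantJetSpace_eq (r : ℕ) :
    invariantJetSpace ρ r = (invariantGerms ρ).map (jetHom n r) :=
  Submodule.copy_eq _ _ _

/-- The orbit of a jet is open if and only if its tangent space at the identity is everything. -/
theorem isOpen_jetOrbit_iff {r : ℕ} (hr : 1 ≤ r) {f : AGerm n} (hf : f ∈ invariantGerms ρ) :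
    IsOpen {a : invariantJets ρ r | (a : JetSpace n r) ∈ jetOrbit ρ r (jet r f)} ↔
      (tangentAlong (idField (ρ := ρ)) f).range.map (jetHom n r)
        = (invariantGerms ρ).map (jetHom n r) := by
  set T := (tangentAlong (idField (ρ := ρ)) f).range.map (jetHom n r)
  set S := invariantJetSpace ρ r with hS
  obtain ⟨d, v, hv⟩ := exists_finite_family ρ r
  set σ := Fintype.linearCombination ℂ v with hσ
  let U : Set (Fin d → ℂ) := {t | IsUnit (fderiv ℂ (σ t).1 0)}
  have hU : IsOpen U := isOpen_setOf_isUnit_fderiv v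
  let P : (Fin d → ℂ) → JetSpace n r := fun t => jet r (fieldPullback (σ t) f)
  -- Projecting to `S`, where all the jets already lie, makes the orbit map take values in the space
  -- in which openness is asked.
  obtain ⟨Lc, hLS⟩ := exists_continuousProjection S
  have hjS : ∀ h ∈ invariantGerms ρ, jet r h ∈ S := by
    intro h hh
    rw [hS, invariantJetSpace_eq]
    exact ⟨h, hh, rfl⟩
  have hPS : ∀ t, P t ∈ S := fun t => hjS _ (fieldPullback_mem _ hf)
  have hPan : ∀ t, AnalyticAt ℂ P t := fun t => (orbitMap_hasFDeriv r v f t).1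
  have hP'an : ∀ t ∈ U, AnalyticAt ℂ (fun t => Lc (P t)) t := fun t _ =>
    AnalyticAt.comp (g := Lc) (Lc.analyticAt _) (hPan t)
  have hder : ∀ t s, (fderiv ℂ (fun t => Lc (P t)) t s : JetSpace n r)
      = jet r (tangentAlong (σ t) f (σ s)) := by
    intro t s
    have h1 := (Lc.hasFDerivAt.comp t (hPan t).differentiableAt.hasFDerivAt).fderiv
    have h2 : fderiv ℂ (fun t => Lc (P t)) t s = Lc (fderiv ℂ P t s) := DFunLike.congr_fun h1 s
    rw [h2, (orbitMap_hasFDeriv r v f t).2 s, hLS _ (hjS _ (tangentAlong_mem _ hf _))]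
  have hrange : ∀ t, (fderiv ℂ (fun t => Lc (P t)) t).range.map S.subtype
      = (tangentAlong (σ t) f).range.map (jetHom n r) := by
    intro t
    refine le_antisymm ?_ ?_
    · rintro _ ⟨_, ⟨s, rfl⟩, rfl⟩
      exact ⟨_, ⟨σ s, rfl⟩, (hder t s).symm⟩
    · rintro _ ⟨_, ⟨w, rfl⟩, rfl⟩
      obtain ⟨s, hs⟩ := hv w
      refine ⟨_, ⟨s, rfl⟩, (hder t s).trans ?_⟩
      rw [jetHom_apply, jet_eq_iff, ← neg_mem_iff, neg_sub, tangentAlong_apply,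
        tangentAlong_apply, ← Finset.sum_sub_distrib]
      refine Ideal.sum_mem _ fun i _ => ?_
      rw [← sub_mul]
      exact Ideal.mul_mem_right _ _ (hs i)
  have hrank : ∀ t ∈ U, Module.finrank ℂ (fderiv ℂ (fun t => Lc (P t)) t).range
      = Module.finrank ℂ T := by
    intro t ht
    rw [← finrank_tangentAlong ht f r, ← hrange t, Submodule.finrank_map_subtype_eq]
  have himage : {a : invariantJets ρ r | (a : JetSpace n r) ∈ jetOrbit ρ r (jet r f)}
      = ((fun t => Lc (P t)) '' U : Set S) := by
    ext a
    change (a : JetSpace n r) ∈ jetOrbit ρ r (jet r f) ↔ _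
    rw [mem_jetOrbit_iff hr hv]
    refine exists_congr fun t => and_congr_right fun _ => ?_
    change _ ↔ Lc (P t) = (a : S)
    rw [hLS _ (hPS t)]
    exact ⟨fun h => Subtype.ext h, fun h => congrArg Subtype.val h⟩
  have hTS : T ≤ S := by
    rintro _ ⟨_, ⟨w, rfl⟩, rfl⟩
    exact hjS _ (tangentAlong_mem _ hf w)
  rw [← invariantJetSpace_eq, ← hS, himage]
  constructor
  · intro hopen
    by_contra hne
    have hlt : Module.finrank ℂ T < Module.finrank ℂ S :=
      Submodule.finrank_lt_finrank_of_lt (lt_of_le_of_ne hTS hne)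
    have hemp := interior_image_eq_empty_of_finrank_lt hU hP'an hrank hlt
    have hopen' : IsOpen ((fun t => Lc (P t)) '' U : Set S) := hopen
    rw [hopen'.interior_eq, Set.image_eq_empty] at hemp
    -- The identity need not belong to the finite family, but its `r`-jet is realized by some `t`;
    -- this shows `U` is nonempty.
    obtain ⟨t, ht⟩ := hv idField
    have : t ∈ U := by
      change IsUnit _
      rw [← fderiv_eq_of_fieldComp_sub_mem fun i => Ideal.pow_le_pow_right (by omega) (ht i)]
      change IsUnit (fderiv ℂ id 0)
      rw [fderiv_id]
      exact isUnit_one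
    rw [hemp] at this
    exact this
  · intro heq
    refine isOpen_image_of_surjective_fderiv (F := S) hU hP'an fun t ht => ?_
    apply Submodule.eq_top_of_finrank_eq
    rw [hrank t ht, heq]

end Orbit

/-! ### Averaging over the group -/

section Averaging

variable {G : Type*} [Group G] {n : ℕ} {ρ : Representation ℂ G (Fin n → ℂ)}

theorem value_germAct (g : G) (h : AGerm n) : (germAct ρ g h).value = h.value := by
  induction h using AGerm.ind with
  | H F hF =>
    change F (ρ g⁻¹ 0) = F 0
    rw [map_zero]

theorem dirDeriv_germAct (g : G) (v : Fin n → ℂ) (h : AGerm n) :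
    dirDeriv v (germAct ρ g h) = germAct ρ g (dirDeriv (ρ g⁻¹ v) h) := by
  induction h using AGerm.ind with
  | H F hF =>
    rw [germAct, pullback_mk, dirDeriv_mk, dirDeriv_mk, pullback_mk, AGerm.mk_eq]
    filter_upwards [(tendsto_representation ρ g⁻¹).eventually hF.eventually_analyticAt] with x hx
    have hc : fderiv ℂ (F ∘ ρ g⁻¹) x
        = (fderiv ℂ F (ρ g⁻¹ x)).comp (LinearMap.toContinuousLinearMap (ρ g⁻¹)) :=
      (hx.differentiableAt.hasFDerivAt.comp x
        (LinearMap.toContinuousLinearMap (ρ g⁻¹)).hasFDerivAt).fderiv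
    rw [hc]
    rfl

variable (ρ) in
theorem sum_representation_mem_invariants [Fintype G] (v : Fin n → ℂ) :
    ∑ g, ρ g v ∈ ρ.invariants := by
  intro a
  rw [map_sum]
  exact (Finset.sum_congr rfl fun g _ => by simp).trans
    (Equiv.sum_comp (Equiv.mulLeft a) fun g => ρ g v)

theorem isInvariant_sum_germAct [Fintype G] (h : AGerm n) :
    IsInvariant ρ (∑ g, germAct ρ g h) := by
  intro a
  rw [map_sum]
  exact (Finset.sum_congr rfl fun g _ => (germAct_mul ρ a g h).symm).trans
    (Equiv.sum_comp (Equiv.mulLeft a) fun g => germAct ρ g h)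

/-- Invariant linear forms separate the invariant vectors. -/
theorem eq_zero_of_invariant_forms [Finite G] {v : Fin n → ℂ} (hv : v ∈ ρ.invariants)
    (h : ∀ l : (Fin n → ℂ) →ₗ[ℂ] ℂ, (∀ g x, l (ρ g x) = l x) → l v = 0) : v = 0 := by
  have := Fintype.ofFinite G
  funext i
  -- The averaged `i`-th coordinate takes the value `|G| * v i` at the invariant vector `v`.
  have h1 := h (∑ g, (LinearMap.proj i).comp (ρ g)) fun a x => by
    simp only [LinearMap.sum_apply, LinearMap.comp_apply, ← Module.End.mul_apply, ← map_mul]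
    exact Equiv.sum_comp (Equiv.mulRight a) fun g => (LinearMap.proj i) (ρ g x)
  have h2 : ∀ g, ρ g v = v := hv
  simpa [LinearMap.sum_apply, h2] using h1

/-- An invariant linear form vanishing on the invariant vectors is zero. -/
theorem invariant_form_eq_zero [Finite G] {l : (Fin n → ℂ) →ₗ[ℂ] ℂ} (hl : ∀ g x, l (ρ g x) = l x)
    (h : ∀ w ∈ ρ.invariants, l w = 0) (v : Fin n → ℂ) : l v = 0 := by
  have := Fintype.ofFinite G
  have h1 := h _ (sum_representation_mem_invariants ρ v)
  rw [map_sum] at h1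
  simpa [hl] using h1

end Averaging

/-! ### Invariants of the Jacobian algebra -/

section Jacobian

variable {G : Type*} [Group G] {n : ℕ} {ρ : Representation ℂ G (Fin n → ℂ)}

theorem dirDeriv_mem_jacobianIdeal (v : Fin n → ℂ) (f : AGerm n) :
    dirDeriv v f ∈ jacobianIdeal f := by
  rw [dirDeriv_eq_sum]
  exact Ideal.sum_mem _ fun i _ =>
    Submodule.smul_of_tower_mem _ _ (Ideal.subset_span (Set.mem_range_self i))

theorem jacobianIdeal_le_maxIdeal {f : AGerm n} (hf : IsCritical f) :
    jacobianIdeal f ≤ maxIdeal n :=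
  Ideal.span_le.2 (by rintro _ ⟨i, rfl⟩; exact hf i)

/-- The space of invariants of the Jacobian algebra is spanned by `1` precisely if all invariant
germs vanishing at the origin belong to the Jacobian ideal. -/
theorem nu_eq_one_iff [Finite G] {f : AGerm n} (hinv : IsInvariant ρ f) (hcrit : IsCritical f) :
    nu ρ f hinv = 1 ↔ ∀ h, IsInvariant ρ h → h ∈ maxIdeal n → h ∈ jacobianIdeal f := by
  have := Fintype.ofFinite G
  have hcard : (Fintype.card G : ℂ) ≠ 0 := Nat.cast_ne_zero.2 Fintype.card_ne_zero
  have hact : ∀ g h, equivariantMilnor ρ f hinv g (Ideal.Quotient.mk _ h)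
      = Ideal.Quotient.mk _ (germAct ρ g h) := fun g h => rfl
  have hmem : ∀ h, IsInvariant ρ h →
      Ideal.Quotient.mk (jacobianIdeal f) h ∈ (equivariantMilnor ρ f hinv).invariants :=
    fun h hh g => by rw [hact, hh]
  have h1inv : IsInvariant ρ (1 : AGerm n) := fun g => map_one _
  let e : (equivariantMilnor ρ f hinv).invariants := ⟨_, hmem 1 h1inv⟩
  have he : e ≠ 0 := by
    intro h0
    have h1 : (1 : AGerm n) ∈ jacobianIdeal f :=
      Ideal.Quotient.eq_zero_iff_mem.1 (congrArg Subtype.val h0)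
    have h2 : valueHom n 1 = 0 := jacobianIdeal_le_maxIdeal hcrit h1
    rw [map_one] at h2
    exact one_ne_zero h2
  have hsmul : ∀ (c : ℂ) h, c • Ideal.Quotient.mk (jacobianIdeal f) h
      = Ideal.Quotient.mk _ (c • h) := fun c h => rfl
  -- Passing to `finrank` is harmless: an infinite cardinal has `toNat` equal to 0, never 1.
  rw [nu, ← Cardinal.toNat_eq_one]
  change Module.finrank ℂ _ = 1 ↔ _
  constructor
  · intro hfr h hh hm
    obtain ⟨c, hc⟩ := exists_smul_eq_of_finrank_eq_one hfr he ⟨_, hmem h hh⟩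
    have h1 : c • Ideal.Quotient.mk (jacobianIdeal f) 1 = Ideal.Quotient.mk _ h :=
      congrArg Subtype.val hc
    rw [hsmul, Ideal.Quotient.eq] at h1
    have h2 : valueHom n (c • 1 - h) = 0 := jacobianIdeal_le_maxIdeal hcrit h1
    have h3 : valueHom n h = 0 := hm
    rw [map_sub, map_smul, map_one, h3, smul_eq_mul, mul_one, sub_zero] at h2
    rw [h2, zero_smul, zero_sub, neg_mem_iff] at h1
    exact h1
  · intro hJ
    refine finrank_eq_one e he fun ⟨q, hq⟩ => ?_
    obtain ⟨h, rfl⟩ := Ideal.Quotient.mk_surjective q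
    -- The group average lifts an invariant class to an invariant germ in the same class.
    let a : AGerm n := (Fintype.card G : ℂ)⁻¹ • ∑ g, germAct ρ g h
    have ha : IsInvariant ρ a := fun g => by
      rw [map_smul, isInvariant_sum_germAct h g]
    have haq : Ideal.Quotient.mk (jacobianIdeal f) a = Ideal.Quotient.mk _ h := by
      rw [← hsmul, map_sum, Finset.sum_congr rfl fun g _ => (hact g h).symm.trans (hq g)]
      rw [Finset.sum_const, Finset.card_univ, ← Nat.cast_smul_eq_nsmul ℂ, smul_smul,
        inv_mul_cancel₀ hcard, one_smul]
    refine ⟨a.value, Subtype.ext ?_⟩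
    change a.value • Ideal.Quotient.mk (jacobianIdeal f) 1 = Ideal.Quotient.mk _ h
    rw [← haq, hsmul, Ideal.Quotient.eq, ← neg_mem_iff, neg_sub]
    refine hJ _ (fun g => ?_) ?_
    · rw [map_sub, ha, map_smul, map_one]
    · change valueHom n _ = 0
      rw [map_sub, map_smul (valueHom n) a.value, map_one, valueHom_apply, smul_eq_mul, mul_one,
        sub_self]

end Jacobian

/-! ### The Hessian on invariant vectors -/

section Hessian

variable {G : Type*} [Group G] {n : ℕ} {ρ : Representation ℂ G (Fin n → ℂ)}

/-- The linear part of a germ at the origin. -/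
def linearPart (h : AGerm n) : (Fin n → ℂ) →ₗ[ℂ] ℂ where
  toFun v := (dirDeriv v h).value
  map_add' v w := by
    simp only [← valueHom_apply, dirDeriv_eq_sum, map_sum, map_smul, smul_eq_mul, Pi.add_apply,
      add_mul, Finset.sum_add_distrib]
  map_smul' c v := by
    simp only [← valueHom_apply, dirDeriv_eq_sum, map_sum, map_smul, smul_eq_mul, Pi.smul_apply,
      Finset.mul_sum, mul_assoc, RingHom.id_apply]

theorem linearPart_apply (h : AGerm n) (v : Fin n → ℂ) :
    linearPart h v = valueHom n (dirDeriv v h) := rfl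

theorem linearPart_add (a b : AGerm n) : linearPart (a + b) = linearPart a + linearPart b :=
  LinearMap.ext fun v => by simp [linearPart_apply]

theorem linearPart_sub (a b : AGerm n) : linearPart (a - b) = linearPart a - linearPart b :=
  LinearMap.ext fun v => by simp [linearPart_apply]

theorem linearPart_mul (a b : AGerm n) (v : Fin n → ℂ) :
    linearPart (a * b) v = a.value * linearPart b v + b.value * linearPart a v := by
  simp only [linearPart_apply, Derivation.leibniz, smul_eq_mul, map_add, map_mul]
  rfl

theorem linearPart_invariant {h : AGerm n} (hh : IsInvariant ρ h) (g : G) (v : Fin n → ℂ) :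
    linearPart h (ρ g v) = linearPart h v := by
  have h1 := dirDeriv_germAct (ρ := ρ) g (ρ g v) h
  rw [hh g] at h1
  rw [linearPart_apply, h1, valueHom_apply, value_germAct]
  simp [linearPart_apply, valueHom_apply]

theorem linearPart_dirDeriv_comm (f : AGerm n) (v w : Fin n → ℂ) :
    linearPart (dirDeriv w f) v = linearPart (dirDeriv v f) w := by
  rw [linearPart_apply, dirDeriv_comm]
  rfl

theorem mem_maxIdeal_sq_iff_linearPart {h : AGerm n} :
    h ∈ maxIdeal n ^ 2 ↔ h.value = 0 ∧ linearPart h = 0 := by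
  rw [mem_maxIdeal_sq]
  refine and_congr_right fun _ => ⟨fun hc => ?_, fun hl i => LinearMap.congr_fun hl _⟩
  refine LinearMap.ext fun v => ?_
  rw [linearPart_apply, dirDeriv_eq_sum, map_sum]
  exact Finset.sum_eq_zero fun i _ => by
    rw [map_smul, valueHom_apply, hc i, smul_zero]

theorem dirDeriv_invariant {f : AGerm n} (hf : IsInvariant ρ f) {v : Fin n → ℂ}
    (hv : v ∈ ρ.invariants) : IsInvariant ρ (dirDeriv v f) := by
  intro g
  have h1 := dirDeriv_germAct (ρ := ρ) g v f
  rw [hf g, hv] at h1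
  exact h1.symm

/-- A vector in the kernel of the Hessian annihilates the linear parts of the Jacobian ideal. -/
theorem linearPart_eq_zero_of_mem_jacobianIdeal {f : AGerm n} (hf : IsCritical f)
    {v : Fin n → ℂ} (hv : linearPart (dirDeriv v f) = 0) {b : AGerm n}
    (hb : b ∈ jacobianIdeal f) : linearPart b v = 0 := by
  refine Submodule.span_induction ?_ ?_ ?_ ?_ hb
  · rintro _ ⟨i, rfl⟩
    change linearPart (dirDeriv (Pi.single i 1) f) v = 0
    rw [linearPart_dirDeriv_comm, hv]
    rfl
  · simp [linearPart_apply]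
  · intro x y _ _ hx hy
    rw [linearPart_add, LinearMap.add_apply, hx, hy, add_zero]
  · intro a x hx' hx
    have h0 : x.value = 0 := jacobianIdeal_le_maxIdeal hf hx'
    rw [smul_eq_mul, linearPart_mul, hx, h0]
    simp

theorem analyticAt_linearForm (l : (Fin n → ℂ) →ₗ[ℂ] ℂ) : AnalyticAt ℂ l 0 :=
  (LinearMap.toContinuousLinearMap l).analyticAt 0

/-- The germ of a linear form. -/
def linearGerm (l : (Fin n → ℂ) →ₗ[ℂ] ℂ) : AGerm n :=
  AGerm.mk l (analyticAt_linearForm l)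

theorem linearGerm_mem (l : (Fin n → ℂ) →ₗ[ℂ] ℂ) : linearGerm l ∈ maxIdeal n :=
  mem_maxIdeal.2 (map_zero l)

theorem linearGerm_invariant {l : (Fin n → ℂ) →ₗ[ℂ] ℂ} (hl : ∀ g x, l (ρ g x) = l x) :
    IsInvariant ρ (linearGerm l) := by
  intro g
  rw [linearGerm, germAct, pullback_mk, AGerm.mk_eq]
  exact Eventually.of_forall fun x => hl _ _

theorem dirDeriv_linearGerm (l : (Fin n → ℂ) →ₗ[ℂ] ℂ) (v : Fin n → ℂ) :
    dirDeriv v (linearGerm l) = algebraMap ℂ _ (l v) := by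
  have : algebraMap ℂ (AGerm n) (l v) = AGerm.mk (fun _ => l v) analyticAt_const := by
    rw [Algebra.algebraMap_eq_smul_one]
    exact (AGerm.mk_smul (F := fun _ => 1) (l v) analyticAt_const).trans
      (AGerm.mk_eq.2 (Eventually.of_forall fun x => mul_one _))
  rw [this, linearGerm, dirDeriv_mk, AGerm.mk_eq]
  exact Eventually.of_forall fun x =>
    DFunLike.congr_fun (LinearMap.toContinuousLinearMap l).fderiv v

theorem linearPart_linearGerm (l : (Fin n → ℂ) →ₗ[ℂ] ℂ) : linearPart (linearGerm l) = l :=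
  LinearMap.ext fun v => by
    rw [linearPart_apply, dirDeriv_linearGerm, AlgHom.commutes]
    rfl

/-- The second derivative of `a * b` along `v` is `a''b + 2a'b' + ab''`; at 0 both factors vanish,
and `b'` does because `v` is in the kernel of the Hessian. -/
theorem sq_linearPart_eq_zero {f : AGerm n} (hf : IsCritical f)
    {v : Fin n → ℂ} (hv : linearPart (dirDeriv v f) = 0) {x : AGerm n}
    (hx : x ∈ maxIdeal n * jacobianIdeal f) : linearPart (dirDeriv v x) v = 0 := by
  refine Submodule.mul_induction_on hx ?_ ?_
  · intro a ha b hb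
    have ha0 : a.value = 0 := ha
    have hb0 : b.value = 0 := jacobianIdeal_le_maxIdeal hf hb
    have hbv := linearPart_eq_zero_of_mem_jacobianIdeal hf hv hb
    have hbv' : (dirDeriv v b).value = 0 := hbv
    rw [Derivation.leibniz, linearPart_add, LinearMap.add_apply, smul_eq_mul, smul_eq_mul,
      linearPart_mul, linearPart_mul, ha0, hb0, hbv, hbv']
    simp
  · intro a b ha hb
    rw [map_add, linearPart_add, LinearMap.add_apply, ha, hb, add_zero]

/-- If the invariant germs of order at least two lie in `𝔪 J_f`, then all invariant germs
vanishing at the origin lie in `J_f`. -/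
theorem mem_jacobianIdeal_of_le_mul [Finite G] {f : AGerm n} (hf : f ∈ invariantGerms ρ)
    (hK : ∀ h ∈ invariantGerms ρ, h ∈ maxIdeal n * jacobianIdeal f) {h : AGerm n}
    (hh : IsInvariant ρ h) (hm : h ∈ maxIdeal n) : h ∈ jacobianIdeal f := by
  have hcrit := (mem_maxIdeal_sq.1 hf.2).2
  have hker : ∀ v ∈ ρ.invariants, linearPart (dirDeriv v f) = 0 → v = 0 := by
    intro v hv h0
    refine eq_zero_of_invariant_forms hv fun l hl => ?_
    -- The square of `l` has second derivative `2 (l v)²` along `v`, which must vanish.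
    have h1 : linearGerm l * linearGerm l ∈ invariantGerms ρ := by
      refine ⟨fun g => by rw [map_mul, linearGerm_invariant hl], ?_⟩
      rw [pow_two]
      exact Ideal.mul_mem_mul (linearGerm_mem l) (linearGerm_mem l)
    have h2 := sq_linearPart_eq_zero hcrit h0 (hK _ h1)
    have h3 : linearPart (algebraMap ℂ (AGerm n) (l v)) v = 0 := by
      rw [linearPart_apply, Derivation.map_algebraMap, map_zero]
    rw [Derivation.leibniz, linearPart_add, LinearMap.add_apply, smul_eq_mul, linearPart_mul,
      dirDeriv_linearGerm, h3, linearPart_linearGerm, ← valueHom_apply, ← valueHom_apply,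
      AlgHom.commutes] at h2
    simpa using h2
  -- The Hessian restricted to the invariant vectors. It is injective, hence onto the dual, so some
  -- ∂_v f with `v` invariant has the same linear part as `h`.
  let β : ρ.invariants →ₗ[ℂ] Module.Dual ℂ ρ.invariants :=
    { toFun := fun v => (linearPart (dirDeriv v.1 f)).comp ρ.invariants.subtype
      map_add' := fun v w => LinearMap.ext fun x => by
        change linearPart (dirDeriv (v.1 + w.1) f) x.1
          = linearPart (dirDeriv v.1 f) x.1 + linearPart (dirDeriv w.1 f) x.1
        simp only [linearPart_dirDeriv_comm f x.1, map_add]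
      map_smul' := fun c v => LinearMap.ext fun x => by
        change linearPart (dirDeriv (c • v.1) f) x.1 = c • linearPart (dirDeriv v.1 f) x.1
        simp only [linearPart_dirDeriv_comm f x.1, map_smul] }
  have hinj : Function.Injective β := by
    rw [injective_iff_map_eq_zero]
    intro v hv
    refine Subtype.ext (hker v.1 v.2 (LinearMap.ext ?_))
    exact invariant_form_eq_zero (ρ := ρ) (linearPart_invariant (dirDeriv_invariant hf.1 v.2))
      fun w hw => LinearMap.congr_fun hv ⟨w, hw⟩
  obtain ⟨v, hv⟩ := (LinearMap.injective_iff_surjective_of_finrank_eq_finrank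
    (Subspace.dual_finrank_eq (K := ℂ)).symm).1 hinj ((linearPart h).comp ρ.invariants.subtype)
  have hvinv := dirDeriv_invariant hf.1 v.2
  have hlin : ∀ w, (linearPart h - linearPart (dirDeriv v.1 f)) w = 0 :=
    invariant_form_eq_zero (ρ := ρ)
      (fun g x => by
        rw [LinearMap.sub_apply, LinearMap.sub_apply, linearPart_invariant hh,
          linearPart_invariant hvinv])
      fun w hw => by
        rw [LinearMap.sub_apply, sub_eq_zero]
        exact (LinearMap.congr_fun hv ⟨w, hw⟩).symm
  have hmem : h - dirDeriv v.1 f ∈ invariantGerms ρ := by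
    refine ⟨fun g => by rw [map_sub, hh, hvinv], mem_maxIdeal_sq_iff_linearPart.2 ⟨?_, ?_⟩⟩
    · exact Ideal.sub_mem _ hm (jacobianIdeal_le_maxIdeal hcrit (dirDeriv_mem_jacobianIdeal _ _))
    · rw [linearPart_sub]
      exact LinearMap.ext hlin
  have h1 := Ideal.add_mem _ (Ideal.mul_le_right (hK _ hmem)) (dirDeriv_mem_jacobianIdeal v.1 f)
  rwa [sub_add_cancel] at h1

end Hessian

/-! ### Finiteness of the ideal of invariant germs and Nakayama's lemma -/

section Nakayama

open Polynomial

theorem pow_mem_of_map_mk_eq_X_pow {R : Type*} [CommRing R] {I : Ideal R} {p : R[X]} {N : ℕ}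
    (hp : p.map (Ideal.Quotient.mk I) = X ^ N) {x : R} (hx : p.eval x = 0) : x ^ N ∈ I := by
  rw [← Ideal.Quotient.eq_zero_iff_mem, map_pow]
  have h := eval_map_apply (f := Ideal.Quotient.mk I) (p := p) x
  rwa [hx, map_zero, hp, eval_pow, eval_X] at h

variable {G : Type*} [Group G] {n : ℕ} {ρ : Representation ℂ G (Fin n → ℂ)}

variable (ρ) in
/-- Germs vanishing at the origin are integral over the invariant germs vanishing there. -/
theorem pow_card_mem_span_invariant [Fintype G] {x : AGerm n} (hx : x ∈ maxIdeal n) :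
    x ^ Fintype.card G ∈ Ideal.span {h : AGerm n | IsInvariant ρ h ∧ h ∈ maxIdeal n} := by
  set I := Ideal.span {h : AGerm n | IsInvariant ρ h ∧ h ∈ maxIdeal n}
  -- The orbit polynomial of `x`: its coefficients are invariant, and at the origin it becomes a
  -- pure power of `X`. Hence its lower coefficients vanish modulo `I`.
  let p : (AGerm n)[X] := ∏ g : G, (X - C (germAct ρ g x))
  have hpinv : ∀ k, IsInvariant ρ (p.coeff k) := by
    intro k a
    have h1 : p.map (germAct ρ a : AGerm n →+* AGerm n) = p := by
      simp only [p, Polynomial.map_prod, Polynomial.map_sub, map_X, map_C]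
      refine Eq.trans (Finset.prod_congr rfl fun g _ => ?_)
        (Equiv.prod_comp (Equiv.mulLeft a) fun g => X - C (germAct ρ g x))
      rw [Equiv.coe_mulLeft, germAct_mul]
      rfl
    conv_rhs => rw [← h1, coeff_map]
    rfl
  have hpval : p.map (valueHom n : AGerm n →+* ℂ) = X ^ Fintype.card G := by
    simp only [p, Polynomial.map_prod, Polynomial.map_sub, map_X, map_C]
    have h1 : ∀ g : G, (valueHom n : AGerm n →+* ℂ) (germAct ρ g x) = 0 := fun g =>
      (value_germAct g x).trans hx
    simp [h1]
  have hpmk : p.map (Ideal.Quotient.mk I) = X ^ Fintype.card G := by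
    ext k
    have h1 : (valueHom n) (p.coeff k) = (X ^ Fintype.card G : ℂ[X]).coeff k := by
      rw [← hpval, coeff_map]
      rfl
    have h2 : p.coeff k - algebraMap ℂ _ (valueHom n (p.coeff k)) ∈ I := by
      refine Ideal.subset_span ⟨fun g => ?_, ?_⟩
      · rw [map_sub, hpinv k g, AlgHom.commutes]
      · change valueHom n _ = 0
        rw [map_sub, AlgHom.commutes]
        exact sub_self _
    rw [coeff_map, Ideal.Quotient.eq.2 h2, h1, coeff_X_pow, coeff_X_pow]
    split_ifs <;> simp
  have hpx : p.eval x = 0 := by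
    rw [eval_prod]
    exact Finset.prod_eq_zero (Finset.mem_univ 1) (by simp [germAct_one])
  exact pow_mem_of_map_mk_eq_X_pow hpmk hpx

variable (ρ) in
theorem maxIdeal_le_radical [Finite G] :
    maxIdeal n ≤ (Ideal.span (invariantGerms ρ : Set (AGerm n))).radical := by
  have := Fintype.ofFinite G
  intro x hx
  -- The factor 2: a product of two invariants in 𝔪 is an invariant in 𝔪².
  refine ⟨Fintype.card G * 2, ?_⟩
  rw [pow_mul, pow_two]
  have h1 := pow_card_mem_span_invariant ρ hx
  have h2 := Ideal.mul_mem_mul h1 h1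
  rw [Ideal.span_mul_span'] at h2
  refine Ideal.span_mono ?_ h2
  rintro _ ⟨a, ⟨ha, ha'⟩, b, ⟨hb, hb'⟩, rfl⟩
  refine ⟨fun g => ?_, ?_⟩
  · change germAct ρ g (a * b) = a * b
    rw [map_mul, ha, hb]
  · rw [pow_two]
    exact Ideal.mul_mem_mul ha' hb'

variable (ρ) in
-- Since K contains 𝔪^N, it is generated by finitely many invariant germs realizing all their
-- `N`-jets together with 𝔪^(N+1), which is finitely generated. Noetherianity of the ring is not
-- needed.
theorem span_invariantGerms_fg [Finite G] {N : ℕ}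
    (hN : maxIdeal n ^ N ≤ Ideal.span (invariantGerms ρ : Set (AGerm n))) :
    (Ideal.span (invariantGerms ρ : Set (AGerm n))).FG := by
  obtain ⟨d, v, hv⟩ := exists_finite_family_of_linearMap
    (A := invariantGerms ρ) (J := JetSpace n N) ((jetHom n N).domRestrict (invariantGerms ρ))
  have heq : Ideal.span (invariantGerms ρ : Set (AGerm n))
      = Ideal.span (Set.range fun i => (v i : AGerm n)) ⊔ maxIdeal n ^ (N + 1) := by
    refine le_antisymm (Ideal.span_le.2 fun h hh => ?_) (sup_le (Ideal.span_mono ?_) ?_)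
    · obtain ⟨t, ht⟩ := hv ⟨h, hh⟩
      have h1 : h - (Fintype.linearCombination ℂ v t : AGerm n) ∈ maxIdeal n ^ (N + 1) :=
        jet_eq_iff.1 ht
      have h2 : (Fintype.linearCombination ℂ v t : AGerm n)
          ∈ Ideal.span (Set.range fun i => (v i : AGerm n)) := by
        rw [Fintype.linearCombination_apply, AddSubmonoidClass.coe_finsetSum]
        exact Ideal.sum_mem _ fun i _ =>
          Submodule.smul_of_tower_mem _ _ (Ideal.subset_span ⟨i, rfl⟩)
      have h3 := Submodule.add_mem_sup h2 h1
      rwa [add_sub_cancel] at h3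
    · rintro _ ⟨i, rfl⟩
      exact (v i).2
    · exact (Ideal.pow_le_pow_right (Nat.le_succ N)).trans hN
  rw [heq]
  exact Submodule.FG.sup (Submodule.fg_span (Set.finite_range _)) (Submodule.FG.pow maxIdeal_fg _)

theorem tangentAlong_id_apply (f : AGerm n) (w : equivariantFields ρ) :
    tangentAlong idField f w = ∑ i, fieldComp w i * f.partialDeriv i := by
  rw [tangentAlong_apply]
  refine Finset.sum_congr rfl fun i _ => ?_
  congr 1
  generalize f.partialDeriv i = h
  induction h using AGerm.ind with
  | H F hF => rfl

/-- If all invariant germs are tangent to the orbit modulo a high power of the maximal ideal, they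
lie in `𝔪 J_f`, by Nakayama's lemma. -/
theorem mem_mul_jacobianIdeal [Finite G] {f : AGerm n} {N r : ℕ} (hr : N ≤ r)
    (hN : maxIdeal n ^ N ≤ Ideal.span (invariantGerms ρ : Set (AGerm n)))
    (hT : ∀ h ∈ invariantGerms ρ, ∃ w : equivariantFields ρ,
      h - tangentAlong idField f w ∈ maxIdeal n ^ (r + 1)) {h : AGerm n}
    (hh : h ∈ invariantGerms ρ) : h ∈ maxIdeal n * jacobianIdeal f := by
  have hle : Ideal.span (invariantGerms ρ : Set (AGerm n)) ≤ maxIdeal n * jacobianIdeal f :=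
    Submodule.le_of_le_smul_of_le_jacobson_bot (span_invariantGerms_fg ρ hN)
      maxIdeal_le_jacobson (Ideal.span_le.2 fun h hh => by
        obtain ⟨w, hw⟩ := hT h hh
        have h1 : tangentAlong idField f w ∈ maxIdeal n * jacobianIdeal f := by
          rw [tangentAlong_id_apply]
          exact Ideal.sum_mem _ fun i _ => Ideal.mul_mem_mul (fieldComp_mem w i)
            (Ideal.subset_span ⟨i, rfl⟩)
        have h2 : h - tangentAlong idField f w
            ∈ maxIdeal n • Ideal.span (invariantGerms ρ : Set (AGerm n)) := by
          -- The error lies in 𝔪^(r+1) = 𝔪 · 𝔪^r, and 𝔪^r ⊆ 𝔪^N ⊆ K, so it falls in 𝔪 K.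
          rw [pow_succ'] at hw
          exact Ideal.mul_mono_right ((Ideal.pow_le_pow_right hr).trans hN) hw
        have h3 := Submodule.add_mem_sup h1 h2
        rwa [add_sub_cancel] at h3)
  exact hle (Ideal.subset_span hh)

end Nakayama

/-! ### Equivariant fields from the Jacobian ideal -/

section VectorFields

variable {G : Type*} [Group G] {n : ℕ} {ρ : Representation ℂ G (Fin n → ℂ)}

theorem sum_compGerm_mul_partialDeriv {u : (Fin n → ℂ) → (Fin n → ℂ)} (hu : AnalyticAt ℂ u 0)
    {F : (Fin n → ℂ) → ℂ} (hF : AnalyticAt ℂ F 0) :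
    ∃ h, ∑ i, compGerm u hu i * (AGerm.mk F hF).partialDeriv i
      = AGerm.mk (fun x => fderiv ℂ F x (u x)) h := by
  have hsum : (fun x => fderiv ℂ F x (u x))
      = fun x => ∑ i, u x i * fderiv ℂ F x (Pi.single i 1) := by
    funext x
    conv_lhs => rw [pi_eq_sum_univ' (u x)]
    simp only [map_sum, map_smul, smul_eq_mul]
  have han : ∀ i, AnalyticAt ℂ (fun x => u x i * fderiv ℂ F x (Pi.single i 1)) 0 := fun i =>
    ((analyticAt_coord i _).comp hu).mul (analyticAt_dirDeriv _ hF)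
  refine ⟨by rw [hsum]; exact Finset.analyticAt_fun_sum _ fun i _ => han i, ?_⟩
  refine (AGerm.mk_sum Finset.univ han).trans (AGerm.mk_eq.2 ?_)
  rw [hsum]

/-- An invariant germ in the Jacobian ideal of an invariant germ is the derivative of that germ
along an equivariant vector field. -/
theorem exists_equivariant_coefficients [Finite G] {f : AGerm n} (hf : IsInvariant ρ f)
    {h : AGerm n} (hh : IsInvariant ρ h) (hJ : h ∈ jacobianIdeal f) :
    ∃ (u : (Fin n → ℂ) → (Fin n → ℂ)) (hu : AnalyticAt ℂ u 0),
      (∀ g x, u (ρ g x) = ρ g (u x)) ∧ ∑ i, compGerm u hu i * f.partialDeriv i = h := by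
  have := Fintype.ofFinite G
  have hcard : (Fintype.card G : ℂ) ≠ 0 := Nat.cast_ne_zero.2 Fintype.card_ne_zero
  obtain ⟨c, hc⟩ := (Submodule.mem_span_range_iff_exists_fun _).1 hJ
  simp only [smul_eq_mul] at hc
  choose a ha hac using fun i => (c i).2
  have hA : AnalyticAt ℂ (fun x i => a i x : (Fin n → ℂ) → (Fin n → ℂ)) 0 :=
    analyticAt_pi_iff.2 ha
  set A : (Fin n → ℂ) → (Fin n → ℂ) := fun x i => a i x
  have hcA : ∀ i, c i = compGerm A hA i := fun i => Subtype.ext (hac i).symm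
  simp_rw [hcA] at hc
  -- The coefficient field averaged over G. Invariance of `f` and `h` makes each summand's
  -- derivative of `f` equal to `h` near 0.
  let u : (Fin n → ℂ) → (Fin n → ℂ) := fun x =>
    (Fintype.card G : ℂ)⁻¹ • ∑ g, ρ g (A (ρ g⁻¹ x))
  have hu : AnalyticAt ℂ u 0 := by
    have hs : AnalyticAt ℂ (fun x => ∑ g, ρ g (A (ρ g⁻¹ x))) 0 := by
      refine Finset.analyticAt_fun_sum _ fun g _ => ?_
      exact AnalyticAt.comp (g := ρ g) (analyticAt_linear _ _)
        (AnalyticAt.comp (g := A) (by rw [map_zero]; exact hA) (analyticAt_linear (ρ g⁻¹) 0))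
    exact (analyticAt_const (v := (Fintype.card G : ℂ)⁻¹)).smul hs
  refine ⟨u, hu, fun b x => ?_, ?_⟩
  · simp only [u, map_smul, map_sum]
    congr 1
    refine ((Equiv.sum_comp (Equiv.mulLeft b) fun g => ρ g (A (ρ g⁻¹ (ρ b x)))).symm).trans ?_
    refine Finset.sum_congr rfl fun g _ => ?_
    simp only [Equiv.coe_mulLeft, mul_inv_rev, map_mul, Module.End.mul_apply]
    congr 3
    rw [← Module.End.mul_apply, ← map_mul, ← Module.End.mul_apply, ← map_mul,
      inv_mul_cancel_right]
  · induction f using AGerm.ind with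
    | H F hF =>
      obtain ⟨k1, e1⟩ := sum_compGerm_mul_partialDeriv hA hF
      obtain ⟨k2, e2⟩ := sum_compGerm_mul_partialDeriv hu hF
      rw [e1] at hc
      rw [e2]
      subst hc
      rw [AGerm.mk_eq]
      have hfg : ∀ᶠ x in 𝓝 (0 : Fin n → ℂ), ∀ g, fderiv ℂ (F ∘ ρ g⁻¹) x = fderiv ℂ F x := by
        refine eventually_all.2 fun g => ?_
        have hg := hf g
        rw [germAct, pullback_mk, AGerm.mk_eq] at hg
        exact hg.fderiv
      have hhg : ∀ᶠ x in 𝓝 (0 : Fin n → ℂ), ∀ g,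
          fderiv ℂ F (ρ g⁻¹ x) (A (ρ g⁻¹ x)) = fderiv ℂ F x (A x) := by
        refine eventually_all.2 fun g => ?_
        have hg := hh g
        rw [germAct, pullback_mk, AGerm.mk_eq] at hg
        exact hg
      have hda : ∀ᶠ x in 𝓝 (0 : Fin n → ℂ), ∀ g, AnalyticAt ℂ F (ρ g⁻¹ x) :=
        eventually_all.2 fun g =>
          (tendsto_representation ρ g⁻¹).eventually hF.eventually_analyticAt
      filter_upwards [hfg, hhg, hda] with x h1 h2 h3
      have h4 : ∀ g, fderiv ℂ F x (ρ g (A (ρ g⁻¹ x))) = fderiv ℂ F x (A x) := by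
        intro g
        have hc : fderiv ℂ (F ∘ ρ g⁻¹) x
            = (fderiv ℂ F (ρ g⁻¹ x)).comp (LinearMap.toContinuousLinearMap (ρ g⁻¹)) :=
          ((h3 g).differentiableAt.hasFDerivAt.comp x
            (LinearMap.toContinuousLinearMap (ρ g⁻¹)).hasFDerivAt).fderiv
        rw [← h2 g, ← h1 g, hc]
        simp
      simp only [u, map_smul, map_sum, h4]
      rw [Finset.sum_const, Finset.card_univ, ← Nat.cast_smul_eq_nsmul ℂ, smul_smul,
        inv_mul_cancel₀ hcard, one_smul]

/-- If all invariant germs vanishing at the origin lie in `J_f`, then every invariant germ of order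
at least two is the derivative of `f` along an equivariant field vanishing at the origin. -/
theorem exists_tangentAlong_eq [Finite G] {f : AGerm n} (hf : f ∈ invariantGerms ρ)
    (hJ : ∀ h, IsInvariant ρ h → h ∈ maxIdeal n → h ∈ jacobianIdeal f) {h : AGerm n}
    (hh : h ∈ invariantGerms ρ) : ∃ w : equivariantFields ρ, tangentAlong idField f w = h := by
  have hcrit := (mem_maxIdeal_sq.1 hf.2).2
  have hlin := mem_maxIdeal_sq_iff_linearPart.1 hh.2
  obtain ⟨u, hu, hue, hsum⟩ := exists_equivariant_coefficients hf.1 hh.1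
    (hJ h hh.1 (mem_maxIdeal.2 hlin.1))
  have hu0inv : u 0 ∈ ρ.invariants := fun g => by rw [← hue, map_zero]
  -- As `f` is critical, the linear part of `∑ uᵢ ∂ᵢf` only sees `u 0`: it is the Hessian contracted
  -- with `u 0`, and it vanishes because `h` has order two.
  have hpart : linearPart (dirDeriv (u 0) f) = 0 := by
    refine LinearMap.ext fun w => ?_
    have h1 : linearPart h w = 0 := by rw [hlin.2]; rfl
    rw [← hsum, linearPart_apply, map_sum, map_sum] at h1
    rw [dirDeriv_eq_sum, linearPart_apply, map_sum, map_sum, LinearMap.zero_apply, ← h1]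
    refine Finset.sum_congr rfl fun i _ => ?_
    have h2 : (f.partialDeriv i).value = 0 := hcrit i
    have h3 : (compGerm u hu i).value = u 0 i := rfl
    rw [Derivation.map_smul, map_smul, ← linearPart_apply, ← linearPart_apply, linearPart_mul, h2,
      h3, zero_mul, add_zero, smul_eq_mul]
  have hu0 : u 0 = 0 := by
    refine eq_zero_of_invariant_forms hu0inv fun l hl => ?_
    have h1 := linearPart_eq_zero_of_mem_jacobianIdeal hcrit hpart
      (hJ _ (linearGerm_invariant hl) (linearGerm_mem l))
    rwa [linearPart_linearGerm] at h1
  refine ⟨⟨u, hu, hu0, fun g => Eventually.of_forall (hue g)⟩, ?_⟩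
  rw [tangentAlong_id_apply, ← hsum]
  rfl

end VectorFields

theorem map_jetHom_tangent_eq_iff {G : Type*} [Group G] {n : ℕ}
    {ρ : Representation ℂ G (Fin n → ℂ)} {f : AGerm n} (hf : f ∈ invariantGerms ρ) (r : ℕ) :
    (tangentAlong (idField (ρ := ρ)) f).range.map (jetHom n r)
        = (invariantGerms ρ).map (jetHom n r) ↔
      ∀ h ∈ invariantGerms ρ, ∃ w : equivariantFields ρ,
        h - tangentAlong idField f w ∈ maxIdeal n ^ (r + 1) := by
  constructor
  · intro heq h hh
    obtain ⟨_, ⟨w, rfl⟩, hw⟩ := heq.ge (Submodule.mem_map_of_mem hh)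
    exact ⟨w, jet_eq_iff.1 hw.symm⟩
  · intro hT
    refine le_antisymm ?_ ?_
    · rintro _ ⟨_, ⟨w, rfl⟩, rfl⟩
      exact ⟨_, tangentAlong_mem _ hf w, rfl⟩
    · rintro _ ⟨h, hh, rfl⟩
      obtain ⟨w, hw⟩ := hT h hh
      exact ⟨_, ⟨w, rfl⟩, (jet_eq_iff.2 hw).symm⟩

end

end EquivariantGerm

theorem theorem3p1 {G : Type*} [Group G] [Finite G] {n : ℕ}
    (ρ : Representation ℂ G (Fin n → ℂ)) (f : EquivariantGerm.AGerm n)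
    (hinv : EquivariantGerm.IsInvariant ρ f) (hzero : f.value = 0)
    (hcrit : EquivariantGerm.IsCritical f) :
    EquivariantGerm.IsEquivariantlyStable ρ f ↔ EquivariantGerm.nu ρ f hinv = 1 := by
  open EquivariantGerm in
  have hf : f ∈ invariantGerms ρ := ⟨hinv, mem_maxIdeal_sq.2 ⟨hzero, hcrit⟩⟩
  rw [nu_eq_one_iff hinv hcrit, IsEquivariantlyStable]
  constructor
  · intro hst
    obtain ⟨N, hN⟩ := Ideal.exists_pow_le_of_le_radical_of_fg (maxIdeal_le_radical ρ) maxIdeal_fg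
    obtain ⟨r, hopen, hr1, hrN⟩ :=
      (hst.and ((eventually_ge_atTop 1).and (eventually_ge_atTop N))).exists
    rw [isOpen_jetOrbit_iff hr1 hf, map_jetHom_tangent_eq_iff hf] at hopen
    exact fun h hh hm =>
      mem_jacobianIdeal_of_le_mul hf (fun _ => mem_mul_jacobianIdeal hrN hN hopen) hh hm
  · intro hJ
    filter_upwards [eventually_ge_atTop 1] with r hr
    rw [isOpen_jetOrbit_iff hr hf, map_jetHom_tangent_eq_iff hf]
    intro h hh
    obtain ⟨w, rfl⟩ := exists_tangentAlong_eq hf hJ hh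
    exact ⟨w, by rw [sub_self]; exact Ideal.zero_mem _⟩
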